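/- **Setting.** Let $M$ be a smooth manifold of dimension $m+1$, $m\ge 1$, with a smooth family of symmetric, nonnegative bilinear forms $\langle\cdot,\cdot\rangle^*$ on the cotangent spaces (a subriemannian metric), and let $dv_M$ be a smooth nowhere vanishing $(m+1)$-form on $M$. Put $|\omega|_*=(\langle\omega,\omega\rangle^*)^{1/2}$, define $G:T^*M\to TM$ by $\omega(G(\eta))=\langle\omega,\eta\rangle^*$, and let $\xi=\mathrm{Range}(G)$. For a $1$-form $\omega$ let $\omega\lrcorner dv_M$ be the $m$-form with $\eta\wedge(\omega\lrcorner dv_M)=\langle\eta,\omega\rangle^*dv_M$ for every $1$-form $\eta$. For $p\ge 0$ and a smooth function $\phi$, the function $H_{\phi,p}$ is defined where $|d\phi|_*\neq 0$ by $$d\Big(\frac{d\phi}{|d\phi|_*^{1-p}}\lrcorner dv_M\Big)=H_{\phi,p}\,dv_M .$$ For smooth vector fields $X_1,\dots,X_r$ on an open set, $\pounds(X_1,\dots,X_r)$ denotes the smallest $C^\infty$-module of vector fields that contains $X_1,\dots,X_r$ and is closed under the Lie bracket; its rank at $x$ is the dimension of the span of the vectors $Z(x)$, $Z\in\pounds(X_1,\dots,X_r)$.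 For a distribution with a local basis of smooth sections $X_1,\dots,X_r$, write $\pounds$ of the distribution for $\pounds(X_1,\dots,X_r)$ (the rank does not depend on the basis). **Theorem.** Let $p_0\in M$ and suppose that, near $p_0$, $\dim\xi=m+1-l$ is constant. Let $\phi,\psi$ be smooth real functions near $p_0$ with $|d\phi|_*\ne0$ and $|d\psi|_*\neq 0$ at $p_0$, and put $\Sigma_1=\{\phi=0\}$, $\Sigma_2=\{\psi=0\}$ (hypersurfaces near $p_0$). Let $p\ge0$, and let $b(x,z,q)$ be a smooth function of $x$ near $p_0$, $z\in\mathbb R$ and $q\in T_x^*M$ with $\partial b/\partial z\le 0$. Assume that near $p_0$ $$H_{\psi,p}+b(x,\psi,d\psi)\le H_{\phi,p}+b(x,\phi,d\phi),\qquad \psi\ge\phi,$$ and that $\psi(p_0)=\phi(p_0)=0$. Then: (a) If $\mathrm{rank}\,\pounds(\xi\cap T\Sigma_1)=m$ at the points of $\Sigma_1$ near $p_0$, then $\psi=\phi=0$ on $\Sigma_1$ near $p_0$, and $\Sigma_2$ coincides with $\Sigma_1$ near $p_0$. (b) If $p>0$ and $\mathrm{rank}\,\pounds(\xi)=m+1$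 near $p_0$, then $\psi=\phi$ near $p_0$. -/

import Mathlib

open Set Filter
open scoped Topology Manifold ContDiff

noncomputable section

namespace Subriemannian

/-- For a bilinear form `B` on the dual of `ℝⁿ`, the linear map `η ↦ ∑ᵢ B(eⁱ, η) eᵢ`, i.e. the one
with `θ (raise B η) = B(θ, η)`. -/
def raise {n : ℕ} (B : LinearMap.BilinForm ℝ (EuclideanSpace ℝ (Fin n) →L[ℝ] ℝ)) :
    (EuclideanSpace ℝ (Fin n) →L[ℝ] ℝ) →ₗ[ℝ] EuclideanSpace ℝ (Fin n) :=
  ∑ i : Fin n, (B (EuclideanSpace.proj i)).smulRight (EuclideanSpace.single i (1 : ℝ))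

theorem apply_raise {n : ℕ} (B : LinearMap.BilinForm ℝ (EuclideanSpace ℝ (Fin n) →L[ℝ] ℝ))
    (θ η : EuclideanSpace ℝ (Fin n) →L[ℝ] ℝ) : θ (raise B η) = B θ η := by
  have h : θ = ∑ i : Fin n, θ (EuclideanSpace.single i (1 : ℝ)) •
      (EuclideanSpace.proj i : EuclideanSpace ℝ (Fin n) →L[ℝ] ℝ) := by
    refine ContinuousLinearMap.coe_injective
      ((EuclideanSpace.basisFun (Fin n) ℝ).toBasis.ext fun j => ?_)
    simp [PiLp.single_apply]
  have h' : B θ η = ∑ i : Fin n, θ (EuclideanSpace.single i (1 : ℝ)) *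
      B (EuclideanSpace.proj i) η := by
    conv_lhs => rw [h, map_sum, LinearMap.sum_apply]
    refine Finset.sum_congr rfl fun i _ => ?_
    rw [map_smul, LinearMap.smul_apply, smul_eq_mul]
  rw [h', raise, LinearMap.sum_apply, map_sum]
  refine Finset.sum_congr rfl fun i _ => ?_
  rw [LinearMap.smulRight_apply, map_smul, smul_eq_mul, mul_comm]

section Basics

variable {m : ℕ} {M : Type*} [TopologicalSpace M]
  [ChartedSpace (EuclideanSpace ℝ (Fin (m + 1))) M]

/-- The differential `df_x`, an element of the cotangent space `T*_x M`. -/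
abbrev differential (f : M → ℝ) (x : M) : TangentSpace (𝓡 (m + 1)) x →L[ℝ] ℝ :=
  mvfderiv (𝓡 (m + 1)) f x

/-- Smoothness of a vector field on a set, as a section of the tangent bundle. -/
def SmoothFieldOn [IsManifold (𝓡 (m + 1)) ∞ M] (U : Set M) (X : Π x : M, TangentSpace (𝓡 (m + 1)) x) : Prop :=
  ContMDiffOn (𝓡 (m + 1)) (𝓡 (m + 1)).tangent ∞
    (fun x => (⟨x, X x⟩ : TangentBundle (𝓡 (m + 1)) M)) U

/-! ### Differential forms -/

/-- A `k`-form on `M` (no smoothness is included). -/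
abbrev Form (m : ℕ) (M : Type*) [TopologicalSpace M]
    [ChartedSpace (EuclideanSpace ℝ (Fin (m + 1))) M] (k : ℕ) : Type _ :=
  Π x : M, TangentSpace (𝓡 (m + 1)) x [⋀^Fin k]→L[ℝ] ℝ

/-- The coordinate expression of a form in the preferred chart at `x₀`: its pullback under the
inverse of that chart. -/
def Form.inChart {k : ℕ} (θ : Form m M k) (x₀ : M) :
    EuclideanSpace ℝ (Fin (m + 1)) → EuclideanSpace ℝ (Fin (m + 1)) [⋀^Fin k]→L[ℝ] ℝ :=
  fun y => (θ ((extChartAt (𝓡 (m + 1)) x₀).symm y)).compContinuousLinearMap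
    (mfderiv 𝓘(ℝ, EuclideanSpace ℝ (Fin (m + 1))) (𝓡 (m + 1))
      (extChartAt (𝓡 (m + 1)) x₀).symm y)

/-- The exterior derivative on `M`: at `x`, it is computed in the preferred chart at `x`. -/
def Form.extDeriv {k : ℕ} (θ : Form m M k) : Form m M (k + 1) :=
  fun x => (_root_.extDeriv (θ.inChart x) (extChartAt (𝓡 (m + 1)) x x)).compContinuousLinearMap
    (mfderiv (𝓡 (m + 1)) 𝓘(ℝ, EuclideanSpace ℝ (Fin (m + 1))) (extChartAt (𝓡 (m + 1)) x) x)

/-- Contraction `ι_v α = α(v, ·, …, ·)` of an alternating form with a vector. -/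
def contract {x : M} {k : ℕ} (v : TangentSpace (𝓡 (m + 1)) x)
    (α : TangentSpace (𝓡 (m + 1)) x [⋀^Fin (k + 1)]→L[ℝ] ℝ) :
    TangentSpace (𝓡 (m + 1)) x [⋀^Fin k]→L[ℝ] ℝ :=
  { α.toAlternatingMap.curryLeft v with
    cont := α.cont.comp (continuous_const.finCons continuous_id) }

/-- `η ∧ (ι_v α) = η(v) α` for a `1`-form `η` and a form `α` of top degree; the left-hand side is
`(w₀, …, w_m) ↦ ∑ᵢ (-1)ⁱ η(wᵢ) (ι_v α)(w₀, …, ŵᵢ, …, w_m)`. -/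
theorem wedge_contract {x : M} (η : TangentSpace (𝓡 (m + 1)) x →L[ℝ] ℝ)
    (v : TangentSpace (𝓡 (m + 1)) x)
    (α : TangentSpace (𝓡 (m + 1)) x [⋀^Fin (m + 1)]→L[ℝ] ℝ) :
    AlternatingMap.alternatizeUncurryFin
      (η.toLinearMap.smulRight (contract v α).toAlternatingMap) = η v • α.toAlternatingMap := by
  ext w
  have key : AlternatingMap.alternatizeUncurryFin (η.toLinearMap.smulRight α.toAlternatingMap)
      (Fin.cons v w) = 0 := by
    apply AlternatingMap.map_linearDependent
    intro h
    have : Module.Finite ℝ (TangentSpace (𝓡 (m + 1)) x) :=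
      inferInstanceAs (Module.Finite ℝ (EuclideanSpace ℝ (Fin (m + 1))))
    have h1 := h.fintype_card_le_finrank
    have h2 : Module.finrank ℝ (TangentSpace (𝓡 (m + 1)) x) = m + 1 :=
      finrank_euclideanSpace_fin (𝕜 := ℝ) (n := m + 1)
    rw [h2] at h1
    simp at h1
  rw [AlternatingMap.alternatizeUncurryFin_apply, Fin.sum_univ_succ] at key
  rw [AlternatingMap.alternatizeUncurryFin_apply]
  have hc : ∀ i : Fin (m + 1), (contract v α).toAlternatingMap (i.removeNth w) =
      α.toAlternatingMap (i.succ.removeNth (Fin.cons v w : Fin (m + 2) → _)) := by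
    intro i
    have : (i.succ.removeNth (Fin.cons v w : Fin (m + 2) → TangentSpace (𝓡 (m + 1)) x)) =
        Fin.cons v (i.removeNth w) := by
      funext j
      refine Fin.cases ?_ (fun j => ?_) j <;> simp [Fin.removeNth]
    rw [this]
    rfl
  simp only [LinearMap.smulRight_apply, AlternatingMap.smul_apply, hc,
    ContinuousLinearMap.coe_coe]
  simp only [Fin.val_zero, pow_zero, one_smul, LinearMap.smulRight_apply,
    AlternatingMap.smul_apply, Fin.cons_zero, Fin.cons_succ, Fin.val_succ, pow_succ, mul_neg,
    mul_one, neg_smul, Finset.sum_neg_distrib, Fin.removeNth_zero, Fin.tail_cons,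
    ContinuousLinearMap.coe_coe] at key
  linarith [key]

/-- A background volume form: a smooth, nowhere vanishing form of top degree. -/
structure VolumeForm (m : ℕ) (M : Type*) [TopologicalSpace M]
    [ChartedSpace (EuclideanSpace ℝ (Fin (m + 1))) M] where
  form : Form m M (m + 1)
  ne_zero : ∀ x, form x ≠ 0
  smooth : ∀ x₀, ContDiffOn ℝ ∞ (form.inChart x₀) (extChartAt (𝓡 (m + 1)) x₀).target

/-! ### Subriemannian metrics -/

/-- A subriemannian metric: a smooth family of symmetric nonnegative bilinear forms on the
cotangent spaces of `M`. Smoothness means that `⟨df, dh⟩` is smooth for all smooth functions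
`f, h` given on an open set (equivalently, all `g^{ij} = ⟨dxⁱ, dxʲ⟩` are smooth in coordinates). -/
structure CoMetric (m : ℕ) (M : Type*) [TopologicalSpace M]
    [ChartedSpace (EuclideanSpace ℝ (Fin (m + 1))) M] where
  inner : Π x : M, LinearMap.BilinForm ℝ (TangentSpace (𝓡 (m + 1)) x →L[ℝ] ℝ)
  symm : ∀ x θ η, inner x θ η = inner x η θ
  nonneg : ∀ x θ, 0 ≤ inner x θ θ
  smooth : ∀ (U : Set M) (f h : M → ℝ), IsOpen U →
    ContMDiffOn (𝓡 (m + 1)) 𝓘(ℝ, ℝ) ∞ f U → ContMDiffOn (𝓡 (m + 1)) 𝓘(ℝ, ℝ) ∞ h U →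
    ContMDiffOn (𝓡 (m + 1)) 𝓘(ℝ, ℝ) ∞ (fun x => inner x (differential f x) (differential h x)) U

namespace CoMetric

variable (g : CoMetric m M)

/-- `|θ|_* = ⟨θ, θ⟩^{1/2}`. -/
def norm {x : M} (θ : TangentSpace (𝓡 (m + 1)) x →L[ℝ] ℝ) : ℝ :=
  √(g.inner x θ θ)

/-- The bundle morphism `G : T*M → TM` determined by `θ (G η) = ⟨θ, η⟩` (see `apply_G`). -/
def G (x : M) : (TangentSpace (𝓡 (m + 1)) x →L[ℝ] ℝ) →ₗ[ℝ] TangentSpace (𝓡 (m + 1)) x :=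
  raise (g.inner x)

theorem apply_G (x : M) (θ η : TangentSpace (𝓡 (m + 1)) x →L[ℝ] ℝ) :
    θ (g.G x η) = g.inner x θ η :=
  apply_raise (g.inner x) θ η

/-- The horizontal distribution `ξ = Range G`. -/
def horizontal (x : M) : Submodule ℝ (TangentSpace (𝓡 (m + 1)) x) :=
  LinearMap.range (g.G x)

/-- The interior product `θ ⌟ dv` of a `1`-form with a volume form, with respect to the metric,
i.e. the form with `η ∧ (θ ⌟ dv) = ⟨η, θ⟩ dv` for all `η` (see `wedge_interior`). -/
def interior {x : M} (θ : TangentSpace (𝓡 (m + 1)) x →L[ℝ] ℝ)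
    (α : TangentSpace (𝓡 (m + 1)) x [⋀^Fin (m + 1)]→L[ℝ] ℝ) :
    TangentSpace (𝓡 (m + 1)) x [⋀^Fin m]→L[ℝ] ℝ :=
  contract (g.G x θ) α

theorem wedge_interior {x : M} (η θ : TangentSpace (𝓡 (m + 1)) x →L[ℝ] ℝ)
    (α : TangentSpace (𝓡 (m + 1)) x [⋀^Fin (m + 1)]→L[ℝ] ℝ) :
    AlternatingMap.alternatizeUncurryFin
      (η.toLinearMap.smulRight (g.interior θ α).toAlternatingMap) =
        g.inner x η θ • α.toAlternatingMap := by
  rw [interior, wedge_contract, apply_G]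

/-- The `m`-form `(dφ / |dφ|_*^{1-p}) ⌟ dv`. -/
def areaForm (dv : VolumeForm m M) (p : ℝ) (φ : M → ℝ) : Form m M m :=
  fun x => g.interior ((g.norm (differential φ x) ^ (1 - p))⁻¹ • differential φ x) (dv.form x)

/-- The generalized mean curvature (`p`-sublaplacian) `H_{φ,p}`, i.e. the function with
`d ((dφ / |dφ|_*^{1-p}) ⌟ dv) = H_{φ,p} dv` (see `extDeriv_areaForm`): the ratio of these two forms
of top degree, evaluated on a basis. -/
def meanCurvature (dv : VolumeForm m M) (p : ℝ) (φ : M → ℝ) (x : M) : ℝ :=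
  (g.areaForm dv p φ).extDeriv x (EuclideanSpace.basisFun (Fin (m + 1)) ℝ) /
    dv.form x (EuclideanSpace.basisFun (Fin (m + 1)) ℝ)

theorem extDeriv_areaForm (dv : VolumeForm m M) (p : ℝ) (φ : M → ℝ) (x : M) :
    (g.areaForm dv p φ).extDeriv x = g.meanCurvature dv p φ x • dv.form x := by
  have key : ∀ α : EuclideanSpace ℝ (Fin (m + 1)) [⋀^Fin (m + 1)]→L[ℝ] ℝ,
      α.toAlternatingMap = α (EuclideanSpace.basisFun (Fin (m + 1)) ℝ) •
        (EuclideanSpace.basisFun (Fin (m + 1)) ℝ).toBasis.det := by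
    intro α
    simpa using α.toAlternatingMap.eq_smul_basis_det
      (EuclideanSpace.basisFun (Fin (m + 1)) ℝ).toBasis
  have key' : ∀ α β : EuclideanSpace ℝ (Fin (m + 1)) [⋀^Fin (m + 1)]→L[ℝ] ℝ, β ≠ 0 →
      α = (α (EuclideanSpace.basisFun (Fin (m + 1)) ℝ) /
        β (EuclideanSpace.basisFun (Fin (m + 1)) ℝ)) • β := by
    intro α β hβ
    have hβ' : β (EuclideanSpace.basisFun (Fin (m + 1)) ℝ) ≠ 0 := by
      intro h0
      apply hβ
      apply ContinuousAlternatingMap.toAlternatingMap_injective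
      rw [key β, h0, zero_smul]
      rfl
    apply ContinuousAlternatingMap.toAlternatingMap_injective
    rw [ContinuousAlternatingMap.toAlternatingMap_smul, key β, smul_smul,
      div_mul_cancel₀ _ hβ', key α]
  exact key' _ _ (dv.ne_zero x)

end CoMetric

/-! ### The Lie module generated by vector fields -/

/-- Membership in `£(X₁, …, X_r)` on the open set `U`: the smallest `C^∞(U)`-module of vector
fields which contains `X₁, …, X_r` and is closed under the Lie bracket. -/
inductive LieSpan (U : Set M) {r : ℕ} (X : Fin r → Π x : M, TangentSpace (𝓡 (m + 1)) x) :
    (Π x : M, TangentSpace (𝓡 (m + 1)) x) → Prop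
  | gen (i : Fin r) : LieSpan U X (X i)
  | zero : LieSpan U X 0
  | add {V W : Π x : M, TangentSpace (𝓡 (m + 1)) x} :
      LieSpan U X V → LieSpan U X W → LieSpan U X (V + W)
  | smul {V : Π x : M, TangentSpace (𝓡 (m + 1)) x} (f : M → ℝ) :
      ContMDiffOn (𝓡 (m + 1)) 𝓘(ℝ, ℝ) ∞ f U → LieSpan U X V → LieSpan U X (fun x => f x • V x)
  | bracket {V W : Π x : M, TangentSpace (𝓡 (m + 1)) x} :
      LieSpan U X V → LieSpan U X W →
        LieSpan U X (VectorField.mlieBracket (𝓡 (m + 1)) V W)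

/-- The rank of `£(X₁, …, X_r)` at `x`: the dimension of the span of all `Z x`, `Z ∈ £`. -/
def lieRank (U : Set M) {r : ℕ} (X : Fin r → Π x : M, TangentSpace (𝓡 (m + 1)) x) (x : M) : ℕ :=
  Module.finrank ℝ
    (Submodule.span ℝ {v : TangentSpace (𝓡 (m + 1)) x | ∃ Z, LieSpan U X Z ∧ Z x = v})

/-- `rank £(D) = k` along `S` near `p₀`, for a distribution `D` along `S ⊆ M`: here
`£(D) = £(X₁, …, X_r)`, where `X₁, …, X_r` are smooth vector fields near `p₀` which form a basis of
`D` at the points of `S`. If `S` is a hypersurface and `D ⊆ TS`, the restriction of `£(D)` to `S`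
depends only on the restrictions of the `Xᵢ` to `S`. -/
def HasLieRankNear [IsManifold (𝓡 (m + 1)) ∞ M] (p₀ : M) (S : Set M)
    (D : Π x : M, Submodule ℝ (TangentSpace (𝓡 (m + 1)) x)) (k : ℕ) : Prop :=
  ∃ (U : Set M) (r : ℕ) (X : Fin r → Π x : M, TangentSpace (𝓡 (m + 1)) x),
    IsOpen U ∧ p₀ ∈ U ∧ (∀ i, SmoothFieldOn U (X i)) ∧
    (∀ x ∈ U ∩ S, LinearIndependent ℝ (fun i => X i x) ∧
      Submodule.span ℝ (Set.range fun i => X i x) = D x) ∧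
    ∀ x ∈ U ∩ S, lieRank U X x = k

/-! ### Lower order terms -/

/-- Smoothness on `U` of a function `b(x, z, q)` of `x ∈ M`, `z ∈ ℝ`, `q ∈ T*_x M`: it is smooth in
all variables when written in coordinates, `q` being given by its components in a chart. -/
def SmoothLowerOrderOn (U : Set M)
    (b : Π x : M, ℝ → (TangentSpace (𝓡 (m + 1)) x →L[ℝ] ℝ) → ℝ) : Prop :=
  ∀ x₀ : M, ContDiffOn ℝ ∞
    (fun w : EuclideanSpace ℝ (Fin (m + 1)) × ℝ × (EuclideanSpace ℝ (Fin (m + 1)) →L[ℝ] ℝ) =>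
      b ((extChartAt (𝓡 (m + 1)) x₀).symm w.1) w.2.1
        (w.2.2.comp (mfderiv (𝓡 (m + 1)) 𝓘(ℝ, EuclideanSpace ℝ (Fin (m + 1)))
          (extChartAt (𝓡 (m + 1)) x₀) ((extChartAt (𝓡 (m + 1)) x₀).symm w.1))))
    (((extChartAt (𝓡 (m + 1)) x₀).target ∩ (extChartAt (𝓡 (m + 1)) x₀).symm ⁻¹' U) ×ˢ
      (Set.univ : Set (ℝ × (EuclideanSpace ℝ (Fin (m + 1)) →L[ℝ] ℝ))))

end Basics

end Subriemannian

end

open Subriemannian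

/-!
Let `F = {ψ = φ}`. Where the ball around `z` touches `F` at `x`, the Hopf lemma applied to the
linearization of the operator at the nonnegative function `ψ - φ` shows that its principal symbol,
`θ ↦ |dφ|_*^{p-1} (|θ|_*² + (p - 1) ⟨dφ, θ⟩² / |dφ|_*²)`, cannot be positive at the normal `z - x`.
Hence the normal is orthogonal to `ξ ∩ ker dφ`, and to all of `ξ` if `p > 0`. By the theorem of Bony
a closed set with this property is invariant under the flows of the vector fields in question,
hence under the flows of their brackets, so that its normals are orthogonal to the whole Lie module.
If the Lie module has full rank, `F` has no normals near `p₀` and is a neighbourhood of `p₀`; in (a)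
this applies to `F ∩ Σ₁` within `Σ₁`.
-/

namespace Subriemannian

/-! ### Closed sets invariant under flows -/

section Invariance

variable {E : Type*} [NormedAddCommGroup E]

theorem norm_le_mul_pow_succ [NormedSpace ℝ E] {f f' : ℝ → E} {T C : ℝ} {k : ℕ} (hC : 0 ≤ C)
    (h0 : f 0 = 0) (hf : ∀ t ∈ Icc 0 T, HasDerivWithinAt f (f' t) (Icc 0 T) t)
    (hf' : ∀ t ∈ Icc 0 T, ‖f' t‖ ≤ C * t ^ k) :
    ∀ t ∈ Icc 0 T, ‖f t‖ ≤ C * t ^ (k + 1) := fun t ht => by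
  have hsub : Icc 0 t ⊆ Icc 0 T := Icc_subset_Icc_right ht.2
  have h := norm_image_sub_le_of_norm_deriv_le_segment' (f := f) (f' := f') (C := C * t ^ k)
    (fun s hs => (hf s (hsub hs)).mono hsub)
    (fun s hs => (hf' s (hsub (Ico_subset_Icc_self hs))).trans
      (by have := hs.1; have := hs.2.le; gcongr)) t (right_mem_Icc.2 ht.1)
  rw [h0, sub_zero, sub_zero] at h
  rwa [pow_succ, ← mul_assoc]

theorem exists_localFlow_mapsTo [NormedSpace ℝ E] [CompleteSpace E] {V : E → E} {x₀ : E}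
    (hV : ContDiffAt ℝ 1 V x₀) {s : Set E} (hs : s ∈ 𝓝 x₀) :
    ∃ δ > 0, ∃ Φ : E → ℝ → E, ∀ y ∈ Metric.ball x₀ δ, Φ y 0 = y ∧
      IsIntegralCurveOn (Φ y) (fun _ => V) (Icc 0 δ) ∧ MapsTo (Φ y) (Icc 0 δ) s := by
  obtain ⟨ε, hε, a, r, L, K, hr, hPL⟩ := IsPicardLindelof.of_contDiffAt_one hV
  obtain ⟨Φ, hΦ, hcont⟩ :=
    (hPL 0).exists_forall_mem_closedBall_eq_hasDerivWithinAt_continuousOn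
  have hΦx₀ : Φ (x₀, 0) = x₀ := (hΦ x₀ (Metric.mem_closedBall_self hr.le)).1
  have hnhds : Metric.closedBall x₀ r ×ˢ Icc (0 - ε) (0 + ε) ∈ 𝓝 (x₀, (0 : ℝ)) :=
    prod_mem_nhds (Metric.closedBall_mem_nhds x₀ hr) (Icc_mem_nhds (by linarith) (by linarith))
  have hpre : Φ ⁻¹' s ∈ 𝓝 (x₀, (0 : ℝ)) :=
    (hcont.continuousAt hnhds).preimage_mem_nhds (by rwa [hΦx₀])
  obtain ⟨δ, hδ, hball⟩ := Metric.nhds_basis_closedBall.mem_iff.1 (inter_mem hnhds hpre)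
  have hmem : ∀ y ∈ Metric.ball x₀ δ, ∀ t ∈ Icc 0 δ, (y, t) ∈
      (Metric.closedBall x₀ r ×ˢ Icc (0 - ε) (0 + ε)) ∩ Φ ⁻¹' s := fun y hy t ht => hball <| by
    rw [← closedBall_prod_same]
    exact ⟨Metric.ball_subset_closedBall hy, by simpa [abs_of_nonneg ht.1] using ht.2⟩
  refine ⟨δ, hδ, fun y t => Φ (y, t), fun y hy => ?_⟩
  have hyr : y ∈ Metric.closedBall x₀ r := (hmem y hy 0 (left_mem_Icc.2 hδ.le)).1.1
  exact ⟨(hΦ y hyr).1,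
    fun t ht => ((hΦ y hyr).2 t (hmem y hy t ht).1.2).mono fun τ hτ => (hmem y hy τ hτ).1.2,
    fun t ht => (hmem y hy t ht).2⟩

theorem exists_integralCurve_taylor_two [NormedSpace ℝ E] {V : E → E} {x₀ : E}
    (hV : ContDiffAt ℝ 2 V x₀) :
    ∃ s ∈ 𝓝 x₀, ∃ C : ℝ, ∀ (γ : ℝ → E) (T : ℝ), IsIntegralCurveOn γ (fun _ => V) (Icc 0 T) →
      MapsTo γ (Icc 0 T) s → ∀ t ∈ Icc 0 T,
        ‖γ t - γ 0 - t • V (γ 0) - (t ^ 2 / 2) • fderiv ℝ V (γ 0) (V (γ 0))‖ ≤ C * t ^ 3 := by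
  have hVV : ContDiffAt ℝ 1 (fun y => fderiv ℝ V y (V y)) x₀ :=
    (hV.fderiv_right (m := 1) (by norm_num)).clm_apply (hV.of_le (by norm_num))
  obtain ⟨K, s₁, hs₁, hK⟩ := hVV.exists_lipschitzOnWith
  have hdiff : ∀ᶠ y in 𝓝 x₀, DifferentiableAt ℝ V y :=
    (hV.eventually (by simp)).mono fun y hy => hy.differentiableAt (by norm_num)
  have hbound : ∀ᶠ y in 𝓝 x₀, ‖V y‖ < ‖V x₀‖ + 1 :=
    hV.continuousAt.norm.eventually_lt_const (by linarith)
  refine ⟨_, inter_mem hs₁ (hdiff.and hbound), K * (‖V x₀‖ + 1), fun γ T hγ hmaps => ?_⟩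
  rcases lt_or_ge T 0 with hT | hT
  · simp [Icc_eq_empty_of_lt hT]
  set D := fderiv ℝ V (γ 0) (V (γ 0))
  have hspeed : ∀ t ∈ Icc 0 T, ‖γ t - γ 0‖ ≤ (‖V x₀‖ + 1) * t ^ (0 + 1) :=
    norm_le_mul_pow_succ (by positivity) (sub_self _) (fun t ht => (hγ t ht).sub_const _)
      fun t ht => by simpa using (hmaps ht).2.2.le
  have haccel : ∀ t ∈ Icc 0 T,
      ‖V (γ t) - V (γ 0) - t • D‖ ≤ K * (‖V x₀‖ + 1) * t ^ (1 + 1) := by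
    refine norm_le_mul_pow_succ (f' := fun t => fderiv ℝ V (γ t) (V (γ t)) - (1 : ℝ) • D)
      (by positivity) (by simp) (fun t ht => ?_) fun t ht => ?_
    · exact (((hmaps ht).2.1.hasFDerivAt.comp_hasDerivWithinAt t (hγ t ht)).sub_const _).sub
        ((hasDerivWithinAt_id t _).smul_const D)
    · rw [one_smul, mul_assoc]
      exact (hK.norm_sub_le (hmaps ht).1 (hmaps (left_mem_Icc.2 hT)).1).trans
        (mul_le_mul_of_nonneg_left (hspeed t ht) K.2)
  refine norm_le_mul_pow_succ (f' := fun t => V (γ t) - V (γ 0) - t • D)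
    (by positivity) (by simp) (fun t ht => ?_) haccel
  have hlin := ((hγ t ht).sub_const (γ 0)).sub ((hasDerivWithinAt_id t _).smul_const (V (γ 0)))
  have hquad := (((hasDerivAt_id t).pow 2).div_const 2).hasDerivWithinAt (s := Icc 0 T)
  exact (hlin.sub (hquad.smul_const D)).congr_deriv (by simp)

variable [InnerProductSpace ℝ E] {F O : Set E} {V W : E → E}

/-- A vector field is tangent to `F` in `O` (in the sense of Bony) if on `F ∩ O` it is orthogonal to
all proximal normals of `F`, i.e. to `z - x` whenever `x` is a point of `F` that is closest to `z`
among the points of `F` near `x`. -/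
def TangentTo (F O : Set E) (V : E → E) : Prop :=
  ∀ x ∈ F ∩ O, ∀ z, IsLocalMinOn (dist · z) F x → inner ℝ (V x) (z - x) = 0

namespace TangentTo

theorem zero : TangentTo F O (0 : E → E) := fun _ _ _ _ => inner_zero_left _

theorem neg (hV : TangentTo F O V) : TangentTo F O (-V) := fun x hx z hz => by
  simp [hV x hx z hz]

theorem add (hV : TangentTo F O V) (hW : TangentTo F O W) :
    TangentTo F O (V + W) := fun x hx z hz => by
  simp [inner_add_left, hV x hx z hz, hW x hx z hz]

theorem smul (hV : TangentTo F O V) (f : E → ℝ) :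
    TangentTo F O (fun x => f x • V x) := fun x hx z hz => by
  simp [inner_smul_left, hV x hx z hz]

theorem congr (hV : TangentTo F O V) (hVW : EqOn V W (F ∩ O)) :
    TangentTo F O W := fun x hx z hz => by
  rw [← hVW hx, hV x hx z hz]

theorem mono {O' : Set E} (hV : TangentTo F O V) (hO : O' ⊆ O) : TangentTo F O' V :=
  fun x hx => hV x ⟨hx.1, hO hx.2⟩

theorem inner_sub_le_mul_norm_sq {K : NNReal} (hV : TangentTo F O V) (hK : LipschitzOnWith K V O)
    {x z : E} (hx : x ∈ F ∩ O) (hz : z ∈ O) (hmin : IsLocalMinOn (dist · z) F x) :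
    inner ℝ (z - x) (V z) ≤ K * ‖z - x‖ ^ 2 := by
  calc inner ℝ (z - x) (V z) = inner ℝ (z - x) (V z - V x) := by
        rw [inner_sub_right, real_inner_comm (V x), hV x hx z hmin, sub_zero]
    _ ≤ ‖z - x‖ * ‖V z - V x‖ := real_inner_le_norm _ _
    _ ≤ ‖z - x‖ * (K * ‖z - x‖) := by gcongr; exact hK.norm_sub_le hz hx.2
    _ = K * ‖z - x‖ ^ 2 := by ring

end TangentTo

theorem eventually_slope_infDist_sq_lt {γ : ℝ → E} {v x : E} {τ ρ : ℝ}
    (hγ : HasDerivWithinAt γ v (Ici τ) τ) (hx : x ∈ F)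
    (hdist : Metric.infDist (γ τ) F = dist (γ τ) x) (hρ : 2 * inner ℝ (γ τ - x) v < ρ) :
    ∀ᶠ t in 𝓝[>] τ,
      (t - τ)⁻¹ * (Metric.infDist (γ t) F ^ 2 - Metric.infDist (γ τ) F ^ 2) < ρ := by
  have hderiv : HasDerivWithinAt (fun t => ‖γ t - x‖ ^ 2) (2 * inner ℝ (γ τ - x) v) (Ioi τ) τ :=
    ((hγ.sub_const x).norm_sq).mono Ioi_subset_Ici_self
  have hslope := (hasDerivWithinAt_iff_tendsto_slope' self_notMem_Ioi).1 hderiv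
  filter_upwards [hslope.eventually_lt_const hρ, self_mem_nhdsWithin] with t hslope ht
  refine lt_of_le_of_lt ?_ hslope
  rw [slope_def_field, div_eq_inv_mul, hdist, dist_eq_norm]
  have hle : Metric.infDist (γ t) F ≤ ‖γ t - x‖ := by
    rw [← dist_eq_norm]
    exact Metric.infDist_le_dist_of_mem hx
  have hpos : 0 ≤ (t - τ)⁻¹ := inv_nonneg.2 (sub_nonneg.2 (mem_Ioi.1 ht).le)
  gcongr
  exact Metric.infDist_nonneg

/-- The radius `3 * r` ensures that the points of `F` nearest to the curve lie where `V` is tangent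
to `F`; then Grönwall's inequality applies to the squared distance from the curve to `F`. -/
theorem TangentTo.mapsTo_of_isIntegralCurveOn [ProperSpace E] (hF : IsClosed F) {x₀ : E} {r : ℝ}
    {K : NNReal} (hV : TangentTo F (Metric.ball x₀ (3 * r)) V)
    (hK : LipschitzOnWith K V (Metric.ball x₀ (3 * r))) {γ : ℝ → E} {T : ℝ} (h0 : γ 0 ∈ F)
    (hγ : IsIntegralCurveOn γ (fun _ => V) (Icc 0 T))
    (hball : MapsTo γ (Icc 0 T) (Metric.ball x₀ r)) : MapsTo γ (Icc 0 T) F := fun t ht => by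
  have hne : F.Nonempty := ⟨_, h0⟩
  have hcont : ContinuousOn (fun t => Metric.infDist (γ t) F ^ 2) (Icc 0 T) :=
    ((Metric.continuous_infDist_pt F).comp_continuousOn
      fun τ hτ => (hγ τ hτ).continuousWithinAt).pow 2
  have hgronwall := le_gronwallBound_of_liminf_deriv_right_le (δ := 0) (K := 2 * K) (ε := 0)
    (f' := fun τ => 2 * K * Metric.infDist (γ τ) F ^ 2) hcont (fun τ hτ ρ hρ => ?_)
    (by simp [Metric.infDist_zero_of_mem h0]) (fun _ _ => by simp) t ht
  · rw [gronwallBound_ε0_δ0] at hgronwall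
    rw [hF.mem_iff_infDist_zero hne]
    exact pow_eq_zero_iff two_ne_zero |>.1 (le_antisymm hgronwall (sq_nonneg _))
  · have hτT : τ ∈ Icc 0 T := Ico_subset_Icc_self hτ
    obtain ⟨x, hx, hdist⟩ := hF.exists_infDist_eq_dist hne (γ τ)
    have hmin : ∀ y ∈ F, dist x (γ τ) ≤ dist y (γ τ) := fun y hy => by
      rw [dist_comm x, ← hdist, dist_comm y]
      exact Metric.infDist_le_dist_of_mem hy
    have hγτ : dist (γ τ) x₀ < r := hball hτT
    have hxball : x ∈ Metric.ball x₀ (3 * r) := by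
      have h0r : dist (γ 0) x₀ < r := hball (left_mem_Icc.2 (hτT.1.trans hτT.2))
      rw [Metric.mem_ball]
      linarith [hmin _ h0, dist_triangle_right (γ 0) (γ τ) x₀, dist_triangle x (γ τ) x₀]
    have hγball : γ τ ∈ Metric.ball x₀ (3 * r) := by
      rw [Metric.mem_ball]
      linarith [dist_nonneg.trans_lt hγτ]
    refine (eventually_slope_infDist_sq_lt (v := V (γ τ)) ?_ hx hdist ?_).frequently
    · exact (hγ τ hτT).mono_of_mem_nhdsWithin (Icc_mem_nhdsGE_of_mem hτ)
    · have hle := hV.inner_sub_le_mul_norm_sq hK ⟨hx, hxball⟩ hγball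
        (IsMinOn.localize fun y hy => hmin y hy)
      rw [hdist, dist_eq_norm] at hρ
      linarith

theorem TangentTo.exists_mapsTo_of_isIntegralCurveOn [ProperSpace E] (hF : IsClosed F)
    (hV : TangentTo F O V) {x₀ : E} (hO : O ∈ 𝓝 x₀) (hV1 : ContDiffAt ℝ 1 V x₀) :
    ∃ s ∈ 𝓝 x₀, ∀ (γ : ℝ → E) (T : ℝ), γ 0 ∈ F →
      IsIntegralCurveOn γ (fun _ => V) (Icc 0 T) → MapsTo γ (Icc 0 T) s →
        MapsTo γ (Icc 0 T) F := by
  obtain ⟨K, s, hs, hK⟩ := hV1.exists_lipschitzOnWith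
  obtain ⟨R, hR, hRs⟩ := Metric.nhds_basis_ball.mem_iff.1 (inter_mem hO hs)
  rw [← mul_div_cancel₀ R (three_ne_zero' ℝ)] at hRs
  exact ⟨Metric.ball x₀ (R / 3), Metric.ball_mem_nhds _ (by positivity), fun γ T h0 hγ hball =>
    (hV.mono fun x hx => (hRs hx).1).mapsTo_of_isIntegralCurveOn hF
      (hK.mono fun x hx => (hRs hx).2) h0 hγ hball⟩

end Invariance

/-! ### Two-jets of curves and Lie brackets -/

section Bracket

open Asymptotics

variable {E : Type*} [NormedAddCommGroup E]

theorem mem_posTangentConeAt_of_isLittleO [NormedSpace ℝ E] {F : Set E} {c : ℝ → E} {x v : E}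
    {k : ℕ} (hk : k ≠ 0) (hc : ∀ᶠ t in 𝓝[>] 0, c t ∈ F)
    (hv : (fun t => c t - (x + t ^ k • v)) =o[𝓝[>] 0] fun t : ℝ => t ^ k) :
    v ∈ posTangentConeAt F x := by
  have hpow : Tendsto (fun t : ℝ => t ^ k) (𝓝[>] 0) (𝓝 0) := by
    simpa [hk] using ((continuous_pow k).tendsto (0 : ℝ)).mono_left nhdsWithin_le_nhds
  refine mem_tangentConeAt_of_seq (𝓝[>] 0) (fun t : ℝ => (t.toNNReal ^ k)⁻¹) (fun t => c t - x)
    ?_ (by simpa using hc) ?_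
  · have hlim := (hv.trans_tendsto hpow).add (hpow.smul_const v)
    rw [zero_smul, add_zero] at hlim
    exact hlim.congr fun t => by abel
  · have hlim := hv.tendsto_inv_smul_nhds_zero.add_const v
    rw [zero_add] at hlim
    refine hlim.congr' ?_
    filter_upwards [self_mem_nhdsWithin] with t (ht : 0 < t)
    simp [NNReal.smul_def, ht.le, ← sub_sub, smul_sub, (pow_pos ht k).ne']

section Jets

variable [NormedSpace ℝ E] {c c' : ℝ → E} {x A B : E}

theorem isLittleO_sub_linear_of_quadratic
    (hc : (fun t => c t - (x + t • A + t ^ 2 • B)) =o[𝓝[>] 0] fun t : ℝ => t ^ 2) :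
    (fun t => c t - (x + t • A)) =o[𝓝[>] 0] fun t : ℝ => t := by
  have hsq : (fun t : ℝ => t ^ 2) =o[𝓝[>] 0] fun t => t :=
    (isLittleO_pow_id one_lt_two).mono nhdsWithin_le_nhds
  have hB : (fun t : ℝ => t ^ 2 • B) =O[𝓝[>] 0] fun t => t ^ 2 :=
    .of_bound ‖B‖ (.of_forall fun t => by rw [norm_smul, mul_comm])
  refine ((hc.trans hsq).add (hB.trans_isLittleO hsq)).congr_left fun t => ?_
  abel

theorem isBigO_sub_of_isLittleO_sub_linear
    (hc : (fun t => c t - (x + t • A)) =o[𝓝[>] 0] fun t : ℝ => t) :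
    (fun t => c t - x) =O[𝓝[>] 0] fun t : ℝ => t := by
  have hA : (fun t : ℝ => t • A) =O[𝓝[>] 0] fun t => t :=
    .of_bound ‖A‖ (.of_forall fun t => by rw [norm_smul, mul_comm])
  exact (hc.isBigO.add hA).congr_left fun t => by abel

theorem tendsto_of_isLittleO_sub_linear
    (hc : (fun t => c t - (x + t • A)) =o[𝓝[>] 0] fun t : ℝ => t) :
    Tendsto c (𝓝[>] 0) (𝓝 x) := by
  simpa using ((isBigO_sub_of_isLittleO_sub_linear hc).trans_tendsto
    (tendsto_id.mono_left nhdsWithin_le_nhds)).add_const x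

theorem isLittleO_comp_sub_linear {V : E → E} {V' : E →L[ℝ] E} (hV : HasFDerivAt V V' x)
    (hc : (fun t => c t - (x + t • A)) =o[𝓝[>] 0] fun t : ℝ => t) :
    (fun t => V (c t) - (V x + t • V' A)) =o[𝓝[>] 0] fun t : ℝ => t := by
  have hremainder := (hV.isLittleO.comp_tendsto (tendsto_of_isLittleO_sub_linear hc)).trans_isBigO
    (isBigO_sub_of_isLittleO_sub_linear hc)
  refine (hremainder.add ((V'.isBigO_comp _ _).trans_isLittleO hc)).congr_left fun t => ?_
  simp only [Function.comp_apply, map_sub, map_add, map_smul]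
  abel

theorem isLittleO_flow_sub_quadratic {V : E → E} (hV : ContDiffAt ℝ 2 V x)
    (hc : (fun t => c t - (x + t • A + t ^ 2 • B)) =o[𝓝[>] 0] fun t : ℝ => t ^ 2)
    (hc' : (fun t => c' t - c t - t • V (c t) - (t ^ 2 / 2) • fderiv ℝ V (c t) (V (c t)))
      =o[𝓝[>] 0] fun t : ℝ => t ^ 2) :
    (fun t => c' t - (x + t • (A + V x) + t ^ 2 • (B + fderiv ℝ V x A +
      (1 / 2 : ℝ) • fderiv ℝ V x (V x)))) =o[𝓝[>] 0] fun t : ℝ => t ^ 2 := by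
  have hc1 := isLittleO_sub_linear_of_quadratic hc
  have hvelocity : (fun t => t • (V (c t) - (V x + t • fderiv ℝ V x A))) =o[𝓝[>] 0]
      fun t : ℝ => t ^ 2 := by
    simpa [sq] using (isBigO_refl (fun t : ℝ => t) (𝓝[>] 0)).smul_isLittleO
      (isLittleO_comp_sub_linear (hV.differentiableAt (by norm_num)).hasFDerivAt hc1)
  have hacceleration : (fun t => (t ^ 2 / 2) • (fderiv ℝ V (c t) (V (c t)) - fderiv ℝ V x (V x)))
      =o[𝓝[>] 0] fun t : ℝ => t ^ 2 := by
    have hcont : ContinuousAt (fun y => fderiv ℝ V y (V y)) x :=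
      ((hV.fderiv_right (m := 1) (by norm_num)).clm_apply
        (hV.of_le (by norm_num : (1 : ℕ∞ω) ≤ 2))).continuousAt
    have hlim := (isLittleO_one_iff ℝ).2 (tendsto_sub_nhds_zero_iff.2
      (hcont.tendsto.comp (tendsto_of_isLittleO_sub_linear hc1)))
    have hsq : (fun t : ℝ => t ^ 2 / 2) =O[𝓝[>] 0] fun t => t ^ 2 := by
      simpa [div_eq_inv_mul] using (isBigO_refl (fun t : ℝ => t ^ 2) (𝓝[>] 0)).const_mul_left 2⁻¹
    simpa using hsq.smul_isLittleO hlim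
  refine (((hc'.add hc).add hvelocity).add hacceleration).congr_left fun t => ?_
  simp only [smul_sub, smul_add, smul_smul]
  module

end Jets

/-- There is a curve in `F` of the form `x + t A + t² B + o(t²)` for small `t > 0`. -/
def HasTwoJetIn [NormedSpace ℝ E] (F : Set E) (x A B : E) : Prop :=
  ∃ c : ℝ → E, (∀ᶠ t in 𝓝[>] 0, c t ∈ F) ∧
    (fun t => c t - (x + t • A + t ^ 2 • B)) =o[𝓝[>] 0] fun t : ℝ => t ^ 2

theorem hasTwoJetIn_zero [NormedSpace ℝ E] {F : Set E} {x : E} (hx : x ∈ F) :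
    HasTwoJetIn F x 0 0 :=
  ⟨fun _ => x, .of_forall fun _ => hx, by simp⟩

variable [InnerProductSpace ℝ E] {F O : Set E} {V W : E → E} {x A B : E}

theorem HasTwoJetIn.flow [ProperSpace E] (hj : HasTwoJetIn F x A B) (hF : IsClosed F)
    (hV : TangentTo F O V) (hO : O ∈ 𝓝 x) (hV2 : ContDiffAt ℝ 2 V x) :
    HasTwoJetIn F x (A + V x) (B + fderiv ℝ V x A + (1 / 2 : ℝ) • fderiv ℝ V x (V x)) := by
  obtain ⟨c, hcF, hc⟩ := hj
  have hV1 : ContDiffAt ℝ 1 V x := hV2.of_le (by norm_num)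
  obtain ⟨s₁, hs₁, C, htaylor⟩ := exists_integralCurve_taylor_two hV2
  obtain ⟨s₂, hs₂, hinv⟩ := hV.exists_mapsTo_of_isIntegralCurveOn hF hO hV1
  obtain ⟨δ, hδ, Φ, hΦ⟩ := exists_localFlow_mapsTo hV1 (inter_mem hs₁ hs₂)
  have hball : ∀ᶠ t in 𝓝[>] (0 : ℝ), c t ∈ Metric.ball x δ :=
    (tendsto_of_isLittleO_sub_linear (isLittleO_sub_linear_of_quadratic hc)).eventually
      (Metric.ball_mem_nhds x hδ)
  have hsmall : ∀ᶠ t in 𝓝[>] (0 : ℝ), t ∈ Icc 0 δ := Icc_mem_nhdsGT hδ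
  refine ⟨fun t => Φ (c t) t, ?_, isLittleO_flow_sub_quadratic hV2 hc ?_⟩
  · filter_upwards [hcF, hball, hsmall] with t htF htball ht
    obtain ⟨h0, hcurve, hmaps⟩ := hΦ _ htball
    exact hinv _ δ (by rwa [h0]) hcurve (fun τ hτ => (hmaps hτ).2) ht
  · refine (IsBigO.of_bound C ?_).trans_isLittleO
      ((isLittleO_pow_pow (𝕜 := ℝ) (by norm_num : 2 < 3)).mono nhdsWithin_le_nhds)
    filter_upwards [hball, hsmall] with t htball ht
    obtain ⟨h0, hcurve, hmaps⟩ := hΦ _ htball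
    simpa [h0, abs_of_nonneg ht.1] using htaylor _ δ hcurve (fun τ hτ => (hmaps hτ).1) t ht

theorem inner_nonpos_of_mem_posTangentConeAt {v z : E} (hz : IsLocalMinOn (dist · z) F x)
    (hv : v ∈ posTangentConeAt F x) : inner ℝ v (z - x) ≤ 0 := by
  have hsq : IsLocalMinOn (fun y => ‖y - z‖ ^ 2) F x := hz.mono fun y hy => by
    simpa only [dist_eq_norm] using pow_le_pow_left₀ dist_nonneg hy 2
  have hderiv := hsq.hasFDerivWithinAt_nonneg
    ((hasFDerivAt_id x).sub_const z).norm_sq.hasFDerivWithinAt hv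
  simp only [id_eq, ContinuousLinearMap.comp_id, smul_apply, innerSL_apply_apply, nsmul_eq_mul,
    Nat.cast_ofNat] at hderiv
  rw [real_inner_comm, ← neg_sub, inner_neg_left]
  linarith

theorem TangentTo.exists_integralCurve_mapsTo [ProperSpace E] (hF : IsClosed F)
    (hV : TangentTo F O V) (hx : x ∈ F) (hO : O ∈ 𝓝 x) (hV1 : ContDiffAt ℝ 1 V x) :
    ∃ δ > 0, ∃ γ : ℝ → E, γ 0 = x ∧ IsIntegralCurveOn γ (fun _ => V) (Icc 0 δ) ∧
      MapsTo γ (Icc 0 δ) (F ∩ O) := by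
  obtain ⟨s, hs, hinv⟩ := hV.exists_mapsTo_of_isIntegralCurveOn hF hO hV1
  obtain ⟨δ, hδ, Φ, hΦ⟩ := exists_localFlow_mapsTo hV1 (inter_mem hs hO)
  obtain ⟨h0, hcurve, hmaps⟩ := hΦ x (Metric.mem_ball_self hδ)
  exact ⟨δ, hδ, Φ x, h0, hcurve, fun t ht =>
    ⟨hinv _ δ (by rwa [h0]) hcurve (fun τ hτ => (hmaps hτ).1) ht, (hmaps ht).2⟩⟩

theorem TangentTo.mem_posTangentConeAt_inter_levelSet [ProperSpace E] (hF : IsClosed F)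
    (hO : IsOpen O) (hV : TangentTo F O V) (hV1 : ContDiffOn ℝ 1 V O) {f : E → ℝ}
    (hf : DifferentiableOn ℝ f O) (hVf : ∀ y ∈ F ∩ O, fderiv ℝ f y (V y) = 0)
    (hx : x ∈ F ∩ f ⁻¹' {0} ∩ O) : V x ∈ posTangentConeAt (F ∩ f ⁻¹' {0}) x := by
  -- the flow of `V` preserves both `F` and the level sets of `f`
  obtain ⟨δ, hδ, γ, h0, hcurve, hmaps⟩ := hV.exists_integralCurve_mapsTo hF hx.1.1
    (hO.mem_nhds hx.2) (hV1.contDiffAt (hO.mem_nhds hx.2))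
  have hconst : ∀ t ∈ Icc 0 δ, f (γ t) = f (γ 0) := by
    have hderiv : ∀ t ∈ Icc 0 δ, HasDerivWithinAt (f ∘ γ) 0 (Icc 0 δ) t := fun t ht =>
      (((hf.differentiableAt (hO.mem_nhds (hmaps ht).2)).hasFDerivAt).comp_hasDerivWithinAt t
        (hcurve t ht)).congr_deriv (hVf _ (hmaps ht))
    exact constant_of_has_deriv_right_zero (fun t ht => (hderiv t ht).continuousWithinAt)
      fun t ht => (hderiv t (Ico_subset_Icc_self ht)).mono_of_mem_nhdsWithin
        (Icc_mem_nhdsGE_of_mem ht)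
  refine mem_posTangentConeAt_of_isLittleO (c := γ) one_ne_zero ?_ ?_
  · filter_upwards [Icc_mem_nhdsGT hδ] with t ht
    exact ⟨(hmaps ht).1, by rw [mem_preimage, hconst t ht, h0]; exact hx.1.2⟩
  · have hderiv := (hcurve 0 (left_mem_Icc.2 hδ.le)).isLittleO.mono
      (nhdsWithin_le_iff.2 (Icc_mem_nhdsGT hδ))
    simpa [h0, sub_sub] using hderiv

theorem TangentTo.inter_levelSet [ProperSpace E] (hF : IsClosed F) (hO : IsOpen O)
    (hV : TangentTo F O V) (hV1 : ContDiffOn ℝ 1 V O) {f : E → ℝ} (hf : DifferentiableOn ℝ f O)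
    (hVf : ∀ y ∈ F ∩ O, fderiv ℝ f y (V y) = 0) : TangentTo (F ∩ f ⁻¹' {0}) O V :=
  fun x hx z hz => by
  have hpos := inner_nonpos_of_mem_posTangentConeAt hz
    (hV.mem_posTangentConeAt_inter_levelSet hF hO hV1 hf hVf hx)
  have hneg := inner_nonpos_of_mem_posTangentConeAt hz
    (hV.neg.mem_posTangentConeAt_inter_levelSet hF hO hV1.neg hf
      (fun y hy => by simp [hVf y hy]) hx)
  rw [Pi.neg_apply, inner_neg_left] at hneg
  linarith

theorem TangentTo.lieBracket_mem_posTangentConeAt [ProperSpace E] (hF : IsClosed F)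
    (hV : TangentTo F O V) (hW : TangentTo F O W) (hx : x ∈ F) (hO : O ∈ 𝓝 x)
    (hV2 : ContDiffAt ℝ 2 V x) (hW2 : ContDiffAt ℝ 2 W x) :
    VectorField.lieBracket ℝ V W x ∈ posTangentConeAt F x := by
  -- the commutator of the flows moves `x` by `t² [V, W] x + o(t²)`
  obtain ⟨c, hcF, hc⟩ := ((((hasTwoJetIn_zero hx).flow hF hV hO hV2).flow hF hW hO hW2).flow hF
    hV.neg hO hV2.neg).flow hF hW.neg hO hW2.neg
  refine mem_posTangentConeAt_of_isLittleO two_ne_zero hcF (hc.congr_left fun t => ?_)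
  simp only [VectorField.lieBracket, fderiv_neg, Pi.neg_apply, map_neg, map_add, map_zero,
    neg_apply, zero_add]
  module

theorem TangentTo.lieBracket [ProperSpace E] (hF : IsClosed F) (hO : IsOpen O)
    (hV : TangentTo F O V) (hW : TangentTo F O W) (hV2 : ContDiffOn ℝ 2 V O)
    (hW2 : ContDiffOn ℝ 2 W O) : TangentTo F O (VectorField.lieBracket ℝ V W) := fun x hx z hz => by
  have hOx := hO.mem_nhds hx.2
  have hVx := hV2.contDiffAt hOx
  have hWx := hW2.contDiffAt hOx
  have hpos := inner_nonpos_of_mem_posTangentConeAt hz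
    (hV.lieBracket_mem_posTangentConeAt hF hW hx.1 hOx hVx hWx)
  have hneg := inner_nonpos_of_mem_posTangentConeAt hz
    (hW.lieBracket_mem_posTangentConeAt hF hV hx.1 hOx hWx hVx)
  rw [VectorField.lieBracket_swap, inner_neg_left] at hneg
  linarith

end Bracket

/-! ### The Hopf lemma for degenerate elliptic operators -/

section Contraction

variable {E : Type*} [NormedAddCommGroup E]

/-- A symmetric nonnegative bilinear form on the dual of `E`, encoded by the map `A` for which
`⟨θ, η⟩ = θ (A η)`. -/
structure IsNonnegForm [NormedSpace ℝ E] (A : StrongDual ℝ E →L[ℝ] E) : Prop where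
  symm : ∀ θ η : StrongDual ℝ E, θ (A η) = η (A θ)
  nonneg : ∀ θ : StrongDual ℝ E, 0 ≤ θ (A θ)

theorem IsNonnegForm.sq_apply_le [NormedSpace ℝ E] {A : StrongDual ℝ E →L[ℝ] E}
    (hA : IsNonnegForm A) (θ η : StrongDual ℝ E) : θ (A η) ^ 2 ≤ θ (A θ) * η (A η) :=
  let B : LinearMap.BilinForm ℝ (StrongDual ℝ E) :=
    LinearMap.mk₂ ℝ (fun θ η => θ (A η)) (by simp) (by simp) (by simp) (by simp)
  B.apply_sq_le_of_symm hA.nonneg ⟨hA.symm⟩ θ η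

/-- The trace of a continuous endomorphism of a finite-dimensional space, as a continuous linear
map. -/
noncomputable def traceL [NormedSpace ℝ E] [FiniteDimensional ℝ E] : (E →L[ℝ] E) →L[ℝ] ℝ :=
  (LinearMap.trace ℝ E ∘ₗ ContinuousLinearMap.coeLM ℝ).toContinuousLinearMap

theorem traceL_apply [NormedSpace ℝ E] [FiniteDimensional ℝ E] (L : E →L[ℝ] E) :
    traceL L = LinearMap.trace ℝ E L := rfl

theorem traceL_smulRight [NormedSpace ℝ E] [FiniteDimensional ℝ E] (θ : StrongDual ℝ E) (v : E) :
    traceL (θ.smulRight v) = θ v :=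
  LinearMap.trace_smulRight (θ : E →ₗ[ℝ] ℝ) v

theorem IsNonnegForm.traceL_comp_nonneg [InnerProductSpace ℝ E] [FiniteDimensional ℝ E]
    {A : StrongDual ℝ E →L[ℝ] E} (hA : IsNonnegForm A) {Q : E →L[ℝ] StrongDual ℝ E}
    (hQ : ∀ v, 0 ≤ Q v v) : 0 ≤ traceL (A ∘L Q) := by
  let T : E →ₗ[ℝ] E := A ∘L innerSL ℝ
  have hT : T.IsSymmetric := fun v w => by
    have := hA.symm (innerSL ℝ w) (innerSL ℝ v)
    simp only [innerSL_apply_apply] at this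
    rw [real_inner_comm]
    exact this
  let e := hT.eigenvectorBasis rfl
  have hTe : ∀ i, A (innerSL ℝ (e i)) = hT.eigenvalues rfl i • e i :=
    hT.apply_eigenvectorBasis rfl
  have heig : ∀ i, 0 ≤ hT.eigenvalues rfl i := fun i => by
    have := hA.nonneg (innerSL ℝ (e i))
    rwa [hTe, map_smul, innerSL_apply_apply, real_inner_self_eq_norm_sq, e.norm_eq_one, one_pow,
      smul_eq_mul, mul_one] at this
  rw [traceL_apply, LinearMap.trace_eq_sum_inner _ e]
  refine Finset.sum_nonneg fun i _ => ?_
  have := hA.symm (innerSL ℝ (e i)) (Q (e i))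
  rw [hTe, map_smul, innerSL_apply_apply] at this
  exact this ▸ mul_nonneg (heig i) (hQ _)

end Contraction

section InteriorMinimum

variable {E : Type*} [NormedAddCommGroup E]

theorem fderiv_fderiv_nonneg_of_isLocalMin [NormedSpace ℝ E] {w : E → ℝ} {y : E}
    (h : IsLocalMin w y) (hw : ContDiffAt ℝ 2 w y) (v : E) : 0 ≤ fderiv ℝ (fderiv ℝ w) y v v := by
  by_contra! hneg
  set ℓ : ℝ → E := fun t => y + t • v
  have hℓ : ∀ t, HasDerivAt ℓ v t := fun t =>
    (((hasDerivAt_id t).smul_const v).const_add y).congr_deriv (one_smul ℝ v)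
  have hℓ0 : ℓ 0 = y := by simp [ℓ]
  have hlim : Tendsto ℓ (𝓝 0) (𝓝 y) := hℓ0 ▸ (hℓ 0).continuousAt.tendsto
  have hderiv : ∀ᶠ t in 𝓝 0, HasDerivAt (w ∘ ℓ) (fderiv ℝ w (ℓ t) v) t := by
    filter_upwards [hlim.eventually (hw.eventually (by simp))] with t ht
    exact (ht.differentiableAt two_ne_zero).hasFDerivAt.comp_hasDerivAt t (hℓ t)
  have hderiv2 : deriv (deriv (w ∘ ℓ)) 0 = fderiv ℝ (fderiv ℝ w) y v v := by
    have hw' : HasFDerivAt (fderiv ℝ w) (fderiv ℝ (fderiv ℝ w) y) (ℓ 0) := hℓ0.symm ▸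
      ((hw.fderiv_right (m := 1) (by norm_num)).differentiableAt one_ne_zero).hasFDerivAt
    rw [EventuallyEq.deriv_eq (hderiv.mono fun t ht => ht.deriv)]
    simpa using ((hw'.comp_hasDerivAt 0 (hℓ 0)).clm_apply (hasDerivAt_const 0 v)).deriv
  have hmin : IsLocalMin (w ∘ ℓ) 0 := by
    filter_upwards [hlim.eventually h] with t ht
    simpa [hℓ0] using ht
  have hmax : IsLocalMax (w ∘ ℓ) 0 := isLocalMax_of_deriv_deriv_neg (hderiv2 ▸ hneg)
    hmin.deriv_eq_zero hderiv.self_of_nhds.continuousAt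
  have hconst : w ∘ ℓ =ᶠ[𝓝 0] fun _ => w (ℓ 0) := by
    filter_upwards [hmin, hmax] with t using fun h1 h2 => le_antisymm h2 h1
  refine hneg.ne ?_
  rw [← hderiv2, hconst.deriv.deriv_eq]
  simp

theorem eventually_fderiv_sub_const_smul [NormedSpace ℝ E] {u g : E → ℝ} {y : E}
    (hu : ContDiffAt ℝ 2 u y) (hg : ContDiffAt ℝ 2 g y) (ε : ℝ) :
    fderiv ℝ (u - ε • g) =ᶠ[𝓝 y] fderiv ℝ u - ε • fderiv ℝ g := by
  filter_upwards [hu.eventually (by simp), hg.eventually (by simp)] with y' hu' hg'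
  exact ((hu'.differentiableAt two_ne_zero).hasFDerivAt.sub
    ((hg'.differentiableAt two_ne_zero).hasFDerivAt.const_smul ε)).fderiv

theorem fderiv_fderiv_sub_const_smul [NormedSpace ℝ E] {u g : E → ℝ} {y : E}
    (hu : ContDiffAt ℝ 2 u y) (hg : ContDiffAt ℝ 2 g y) (ε : ℝ) :
    fderiv ℝ (fderiv ℝ (u - ε • g)) y =
      fderiv ℝ (fderiv ℝ u) y - ε • fderiv ℝ (fderiv ℝ g) y := by
  have hdiff : ∀ {f : E → ℝ}, ContDiffAt ℝ 2 f y →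
      HasFDerivAt (fderiv ℝ f) (fderiv ℝ (fderiv ℝ f) y) y := fun hf =>
    ((hf.fderiv_right (m := 1) (by norm_num)).differentiableAt one_ne_zero).hasFDerivAt
  rw [(eventually_fderiv_sub_const_smul hu hg ε).fderiv_eq]
  exact ((hdiff hu).sub ((hdiff hg).const_smul ε)).fderiv

theorem exists_isLocalMin_sub_const_smul [ProperSpace E] {u g : E → ℝ}
    {x : E} {r : ℝ} (hr : 0 < r) (hu : ContinuousOn u (Metric.closedBall x r))
    (hg : ContinuousOn g (Metric.closedBall x r)) (hnn : ∀ y ∈ Metric.closedBall x r, 0 ≤ u y)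
    (hux : u x = 0) (hne : ∀ y ∈ Metric.sphere x r, g x ≤ g y → u y ≠ 0) :
    ∃ ε > 0, ∃ y ∈ Metric.ball x r, IsLocalMin (u - ε • g) y ∧ u y ≤ ε * (g y - g x) := by
  have hsub : Metric.sphere x r ⊆ Metric.closedBall x r := Metric.sphere_subset_closedBall
  obtain ⟨δ, hδ, hδu⟩ : ∃ δ > 0, ∀ y ∈ Metric.sphere x r, g x ≤ g y → δ ≤ u y := by
    have hcomp : IsCompact (Metric.sphere x r ∩ {y ∈ Metric.closedBall x r | g x ≤ g y}) :=
      (isCompact_sphere x r).inter_right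
        (hg.preimage_isClosed_of_isClosed Metric.isClosed_closedBall isClosed_Ici)
    obtain ⟨δ, hδ, hle⟩ := hcomp.exists_forall_le' (hu.mono fun y hy => hsub hy.1) (a := 0)
      fun y hy => (hnn y (hsub hy.1)).lt_of_ne' (hne y hy.1 hy.2.2)
    exact ⟨δ, hδ, fun y hy hgy => hle y ⟨hy, hsub hy, hgy⟩⟩
  obtain ⟨C, hC⟩ := (isCompact_sphere x r).bddAbove_image (hg.mono hsub)
  have hM : 0 < |C - g x| + 1 := by positivity
  set ε := δ / (|C - g x| + 1)
  have hε : 0 < ε := div_pos hδ hM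
  have hsphere : ∀ y ∈ Metric.sphere x r, (u - ε • g) x < (u - ε • g) y := fun y hy => by
    simp only [Pi.sub_apply, Pi.smul_apply, smul_eq_mul, hux]
    rcases le_or_gt (g x) (g y) with hgy | hgy
    · have hgC : g y - g x < |C - g x| + 1 := by
        linarith [hC (mem_image_of_mem g hy), le_abs_self (C - g x)]
      have := mul_lt_mul_of_pos_left hgC hε
      rw [div_mul_cancel₀ _ hM.ne'] at this
      linarith [hδu y hy hgy]
    · linarith [hnn y (hsub hy), mul_lt_mul_of_pos_left hgy hε]
  obtain ⟨y, hy, hmin⟩ := (isCompact_closedBall x r).exists_isMinOn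
    ⟨x, Metric.mem_closedBall_self hr.le⟩ (hu.sub (hg.const_smul ε))
  have hyx : (u - ε • g) y ≤ (u - ε • g) x := hmin (Metric.mem_closedBall_self hr.le)
  have hball : y ∈ Metric.ball x r := (Metric.mem_closedBall.1 hy).lt_of_ne fun h =>
    (hsphere y h).not_ge hyx
  refine ⟨ε, hε, y, hball, hmin.isLocalMin (Metric.closedBall_mem_nhds_of_mem hball), ?_⟩
  simp only [Pi.sub_apply, Pi.smul_apply, smul_eq_mul, hux] at hyx
  linarith

end InteriorMinimum

section Hopf

variable {E : Type*} [NormedAddCommGroup E]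

/-- The barrier function of the Hopf lemma. -/
noncomputable def gaussian (α : ℝ) (z y : E) : ℝ := Real.exp (-α * ‖y - z‖ ^ 2)

theorem gaussian_pos (α : ℝ) (z y : E) : 0 < gaussian α z y := Real.exp_pos _

theorem gaussian_le_gaussian_iff {α : ℝ} (hα : 0 < α) {z x y : E} :
    gaussian α z x ≤ gaussian α z y ↔ dist y z ≤ dist x z := by
  rw [gaussian, gaussian, Real.exp_le_exp, neg_mul, neg_mul, neg_le_neg_iff,
    mul_le_mul_iff_right₀ hα, pow_le_pow_iff_left₀ (norm_nonneg _) (norm_nonneg _) two_ne_zero,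
    dist_eq_norm, dist_eq_norm]

variable [InnerProductSpace ℝ E]

theorem contDiff_gaussian {k : WithTop ℕ∞} (α : ℝ) (z : E) : ContDiff ℝ k (gaussian α z) :=
  (contDiff_const.mul ((contDiff_id.sub contDiff_const).norm_sq ℝ)).exp

theorem hasFDerivAt_gaussian (α : ℝ) (z y : E) :
    HasFDerivAt (gaussian α z) ((-(2 * α) * gaussian α z y) • innerSL ℝ (y - z)) y := by
  have hsq : HasFDerivAt (fun y : E => ‖y - z‖ ^ 2) (2 • innerSL ℝ (y - z)) y := by
    simpa using! ((hasFDerivAt_id y).sub_const z).norm_sq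
  refine ((hsq.const_mul (-α)).exp).congr_fderiv ?_
  ext v
  simp only [gaussian, smul_apply, smul_eq_mul, nsmul_eq_mul, Nat.cast_ofNat]
  ring

theorem norm_fderiv_gaussian {α : ℝ} (hα : 0 ≤ α) (z y : E) :
    ‖fderiv ℝ (gaussian α z) y‖ = gaussian α z y * (2 * α * ‖y - z‖) := by
  rw [(hasFDerivAt_gaussian α z y).fderiv, norm_smul, innerSL_apply_norm, norm_mul, norm_neg,
    Real.norm_of_nonneg (by positivity), Real.norm_of_nonneg (gaussian_pos α z y).le]
  ring

theorem fderiv_fderiv_gaussian (α : ℝ) (z y v : E) :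
    fderiv ℝ (fderiv ℝ (gaussian α z)) y v = gaussian α z y •
      ((4 * α ^ 2 * inner ℝ (y - z) v) • innerSL ℝ (y - z) - (2 * α) • innerSL ℝ v) := by
  have hinner : HasFDerivAt (fun y : E => innerSL ℝ (y - z)) (innerSL ℝ : E →L[ℝ] E →L[ℝ] ℝ) y :=
    (innerSL ℝ : E →L[ℝ] E →L[ℝ] ℝ).hasFDerivAt.comp y ((hasFDerivAt_id y).sub_const z)
  rw [funext fun y => (hasFDerivAt_gaussian α z y).fderiv,
    (((hasFDerivAt_gaussian α z y).const_mul (-(2 * α))).fun_smul hinner).fderiv]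
  ext w
  have hv : (innerSL ℝ : E →L[ℝ] E →L[ℝ] ℝ) v w = inner ℝ v w := rfl
  simp only [add_apply, smul_apply, sub_apply, ContinuousLinearMap.smulRight_apply,
    innerSL_apply_apply, smul_eq_mul, hv]
  ring

section Barrier

variable [FiniteDimensional ℝ E] {S : E → StrongDual ℝ E →L[ℝ] E} {x z : E}

theorem traceL_comp_fderiv_fderiv_gaussian (A : StrongDual ℝ E →L[ℝ] E) (α : ℝ) (z y : E) :
    traceL (A ∘L fderiv ℝ (fderiv ℝ (gaussian α z)) y) = gaussian α z y *
      (4 * α ^ 2 * innerSL ℝ (y - z) (A (innerSL ℝ (y - z))) -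
        2 * α * traceL (A ∘L innerSL ℝ)) := by
  have hcomp : A ∘L fderiv ℝ (fderiv ℝ (gaussian α z)) y = gaussian α z y •
      ((4 * α ^ 2) • (innerSL ℝ (y - z)).smulRight (A (innerSL ℝ (y - z))) -
        (2 * α) • (A ∘L innerSL ℝ)) := by
    ext1 v
    simp [fderiv_fderiv_gaussian, mul_smul, inner_sub_left]
  rw [hcomp, map_smul, map_sub, map_smul, map_smul, traceL_smulRight, smul_eq_mul, smul_eq_mul,
    smul_eq_mul]

theorem exists_gaussian_strict_subsolution (hS : ContinuousAt S x)
    (hpos : 0 < innerSL ℝ (x - z) (S x (innerSL ℝ (x - z)))) (K : ℝ) :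
    ∃ α > 0, ∀ᶠ y in 𝓝 x, K * (‖fderiv ℝ (gaussian α z) y‖ + gaussian α z y) <
      traceL (S y ∘L fderiv ℝ (fderiv ℝ (gaussian α z)) y) := by
  let P : ℝ → E → ℝ := fun α y => 4 * α ^ 2 * innerSL ℝ (y - z) (S y (innerSL ℝ (y - z))) -
    2 * α * traceL (S y ∘L innerSL ℝ) - K * (2 * α * ‖y - z‖ + 1)
  obtain ⟨α, hP, hα⟩ : ∃ α, 0 < P α x ∧ 0 < α := by
    set s := innerSL ℝ (x - z) (S x (innerSL ℝ (x - z)))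
    set t := traceL (S x ∘L innerSL ℝ)
    have hlin : Tendsto (fun α : ℝ => α * (4 * s) - (2 * t + 2 * K * ‖x - z‖)) atTop atTop :=
      tendsto_atTop_add_const_right _ _ (tendsto_id.atTop_mul_const (by positivity))
    have htop : Tendsto (fun α => P α x) atTop atTop := by
      refine (tendsto_atTop_add_const_right _ (-K) (tendsto_id.atTop_mul_atTop₀ hlin)).congr
        fun α => ?_
      simp only [P, id]
      ring
    exact ((htop.eventually_gt_atTop 0).and (eventually_gt_atTop 0)).exists
  have hcont : ContinuousAt (P α) x := by
    have hinner : ContinuousAt (fun y => innerSL ℝ (y - z)) x := by fun_prop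
    have htrace : ContinuousAt (fun y => traceL (S y ∘L innerSL ℝ)) x :=
      traceL.continuous.continuousAt.comp (hS.clm_comp continuousAt_const)
    exact ((continuousAt_const.mul (hinner.clm_apply (hS.clm_apply hinner))).sub
      (continuousAt_const.mul htrace)).sub (by fun_prop)
  refine ⟨α, hα, (hcont.eventually_const_lt hP).mono fun y hy => ?_⟩
  rw [norm_fderiv_gaussian hα.le, traceL_comp_fderiv_fderiv_gaussian, ← sub_pos]
  exact (mul_pos (gaussian_pos α z y) hy).trans_eq (by ring)

end Barrier

theorem dist_midpoint_lt {x y z : E} (hyx : y ≠ x) (hyz : dist x z ≤ dist y z) :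
    dist x (midpoint ℝ x z) < dist y (midpoint ℝ x z) := by
  have hpar := parallelogram_law_with_norm ℝ (y - x) (y - z)
  have hadd : y - x + (y - z) = (2 : ℝ) • (y - midpoint ℝ x z) := by
    rw [midpoint_eq_smul_add, invOf_eq_inv]
    module
  rw [hadd, sub_sub_sub_cancel_left, norm_smul, Real.norm_ofNat] at hpar
  have hpos : 0 < ‖y - x‖ := norm_pos_iff.2 (sub_ne_zero.2 hyx)
  refine lt_of_pow_lt_pow_left₀ 2 dist_nonneg ?_
  rw [dist_eq_norm, dist_eq_norm] at hyz
  rw [dist_left_midpoint, Real.norm_ofNat, dist_eq_norm, dist_eq_norm]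
  rw [norm_sub_rev z x] at hpar
  nlinarith [norm_nonneg (x - z)]

section

variable [FiniteDimensional ℝ E] {u : E → ℝ} {S : E → StrongDual ℝ E →L[ℝ] E} {x z : E} {K : ℝ}
  {N : Set E}

/-- The zero set of `u` lies outside the ball around `z` that touches it at `x`; a multiple of the
barrier below `u` touches `u` from below at an interior point, contradicting the inequality. -/
theorem apply_nonpos_of_strict_normal (hN : N ∈ 𝓝 x) (hu : ∀ y ∈ N, ContDiffAt ℝ 2 u y)
    (hnn : ∀ y ∈ N, 0 ≤ u y) (hS : ∀ y ∈ N, IsNonnegForm (S y)) (hSx : ContinuousAt S x)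
    (hineq : ∀ y ∈ N, traceL (S y ∘L fderiv ℝ (fderiv ℝ u) y) ≤ K * (‖fderiv ℝ u y‖ + |u y|))
    (hux : u x = 0) (hz : ∀ y ∈ N, u y = 0 → y ≠ x → dist x z < dist y z) :
    innerSL ℝ (x - z) (S x (innerSL ℝ (x - z))) ≤ 0 := by
  by_contra! hpos
  obtain ⟨α, hα, hbarrier⟩ := exists_gaussian_strict_subsolution hSx hpos |K|
  set g := gaussian α z
  obtain ⟨r, hr, hrN⟩ := Metric.nhds_basis_closedBall.mem_iff.1 (inter_mem hN hbarrier)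
  obtain ⟨ε, hε, y, hy, hmin, huy⟩ := exists_isLocalMin_sub_const_smul hr
    (fun y hy => (hu y (hrN hy).1).continuousAt.continuousWithinAt)
    (contDiff_gaussian (k := 0) α z).continuous.continuousOn (fun y hy => hnn y (hrN hy).1) hux
    fun y hy hgy h0 => by
      have hyx : y ≠ x := Metric.ne_of_mem_sphere hy hr.ne'
      exact ((gaussian_le_gaussian_iff hα).1 hgy).not_gt
        (hz y (hrN (Metric.sphere_subset_closedBall hy)).1 h0 hyx)
  obtain ⟨hyN, hyg⟩ := hrN (Metric.ball_subset_closedBall hy)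
  have hg : ContDiffAt ℝ 2 g y := (contDiff_gaussian α z).contDiffAt
  have hd1 : fderiv ℝ u y = ε • fderiv ℝ g y := sub_eq_zero.1
    ((eventually_fderiv_sub_const_smul (hu y hyN) hg ε).self_of_nhds.symm.trans hmin.fderiv_eq_zero)
  have hd2 : ε * traceL (S y ∘L fderiv ℝ (fderiv ℝ g) y) ≤
      traceL (S y ∘L fderiv ℝ (fderiv ℝ u) y) := by
    have := (hS y hyN).traceL_comp_nonneg
      (fderiv_fderiv_nonneg_of_isLocalMin hmin ((hu y hyN).sub (hg.const_smul ε)))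
    rwa [fderiv_fderiv_sub_const_smul (hu y hyN) hg, ContinuousLinearMap.comp_sub,
      ContinuousLinearMap.comp_smul, map_sub, map_smul, smul_eq_mul, sub_nonneg] at this
  have huε : ‖fderiv ℝ u y‖ + |u y| ≤ ε * (‖fderiv ℝ g y‖ + g y) := by
    rw [hd1, norm_smul, Real.norm_of_nonneg hε.le, abs_of_nonneg (hnn y hyN), mul_add]
    linarith [mul_pos hε (gaussian_pos α z x)]
  refine lt_irrefl (ε * (|K| * (‖fderiv ℝ g y‖ + g y))) ?_
  calc ε * (|K| * (‖fderiv ℝ g y‖ + g y))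
      < ε * traceL (S y ∘L fderiv ℝ (fderiv ℝ g) y) := mul_lt_mul_of_pos_left (mem_ofPred.1 hyg) hε
    _ ≤ K * (‖fderiv ℝ u y‖ + |u y|) := hd2.trans (hineq y hyN)
    _ ≤ |K| * (‖fderiv ℝ u y‖ + |u y|) := by gcongr; exact le_abs_self K
    _ ≤ |K| * (ε * (‖fderiv ℝ g y‖ + g y)) := by gcongr
    _ = ε * (|K| * (‖fderiv ℝ g y‖ + g y)) := by ring

theorem apply_nonpos_of_normal (hN : N ∈ 𝓝 x) (hu : ∀ y ∈ N, ContDiffAt ℝ 2 u y)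
    (hnn : ∀ y ∈ N, 0 ≤ u y) (hS : ∀ y ∈ N, IsNonnegForm (S y)) (hSx : ContinuousAt S x)
    (hineq : ∀ y ∈ N, traceL (S y ∘L fderiv ℝ (fderiv ℝ u) y) ≤ K * (‖fderiv ℝ u y‖ + |u y|))
    (hux : u x = 0) (hz : ∀ y ∈ N, u y = 0 → dist x z ≤ dist y z) :
    innerSL ℝ (z - x) (S x (innerSL ℝ (z - x))) ≤ 0 := by
  have hmid := apply_nonpos_of_strict_normal (z := midpoint ℝ x z) hN hu hnn hS hSx hineq hux
    fun y hy hy0 hyx => dist_midpoint_lt hyx (hz y hy hy0)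
  have hsub : x - midpoint ℝ x z = -(1 / 2 : ℝ) • (z - x) := by
    rw [midpoint_eq_smul_add, invOf_eq_inv]
    module
  rw [hsub] at hmid
  simp only [map_smul, smul_apply, smul_eq_mul] at hmid
  linarith

end

end Hopf

/-! ### The linearized operator in coordinates -/

section Flux

variable {E : Type*} [NormedAddCommGroup E] [NormedSpace ℝ E]

/-- The vector `|q|^{p-1} A q`, where `A` raises indices and `|q|² = q (A q)`. -/
noncomputable def flux (p : ℝ) (A : StrongDual ℝ E →L[ℝ] E) (q : StrongDual ℝ E) : E :=
  (√(q (A q)) ^ (1 - p))⁻¹ • A q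

/-- The form `|q|^{p-1} (A + (p - 1) |q|⁻² Aq ⊗ Aq)`, which is the derivative of the flux in `q`. -/
noncomputable def fluxSymbol (p : ℝ) (A : StrongDual ℝ E →L[ℝ] E) (q : StrongDual ℝ E) :
    StrongDual ℝ E →L[ℝ] E :=
  (√(q (A q)) ^ (1 - p))⁻¹ •
    (A + ((p - 1) / q (A q)) • (ContinuousLinearMap.apply ℝ ℝ (A q)).smulRight (A q))

variable {A : StrongDual ℝ E →L[ℝ] E} {p : ℝ} {q : StrongDual ℝ E}

theorem fluxSymbol_apply (η : StrongDual ℝ E) : fluxSymbol p A q η =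
    (√(q (A q)) ^ (1 - p))⁻¹ • (A η + ((p - 1) / q (A q) * η (A q)) • A q) := by
  simp [fluxSymbol, mul_smul]

theorem inv_sqrt_rpow_pos {s : ℝ} (hs : 0 < s) (p : ℝ) : 0 < (√s ^ (1 - p))⁻¹ :=
  inv_pos.2 (Real.rpow_pos_of_pos (Real.sqrt_pos.2 hs) _)

/-- The form splits orthogonally along `q`: it is `A` on the part of `θ` orthogonal to `q`, and
`p A` along `q`. -/
theorem apply_fluxSymbol_self (hA : IsNonnegForm A) (hq : 0 < q (A q)) (θ : StrongDual ℝ E) :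
    θ (fluxSymbol p A q θ) = (√(q (A q)) ^ (1 - p))⁻¹ *
      ((θ - (θ (A q) / q (A q)) • q) (A (θ - (θ (A q) / q (A q)) • q)) +
        p * (θ (A q) ^ 2 / q (A q))) := by
  have hq' := hq.ne'
  simp only [fluxSymbol_apply, map_smul, map_add, map_sub, sub_apply, smul_apply, smul_eq_mul,
    hA.symm q θ]
  field_simp
  ring

theorem isNonnegForm_fluxSymbol (hA : IsNonnegForm A) (hp : 0 ≤ p) (hq : 0 < q (A q)) :
    IsNonnegForm (fluxSymbol p A q) where
  symm θ η := by
    simp only [fluxSymbol_apply, map_smul, map_add, smul_eq_mul, hA.symm θ η]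
    ring
  nonneg θ := by
    rw [apply_fluxSymbol_self hA hq]
    have := hA.nonneg (θ - (θ (A q) / q (A q)) • q)
    have := inv_sqrt_rpow_pos hq p
    positivity

theorem apply_eq_zero_of_apply_fluxSymbol_nonpos (hA : IsNonnegForm A) (hp : 0 ≤ p)
    (hq : 0 < q (A q)) {θ : StrongDual ℝ E} (hθ : θ (fluxSymbol p A q θ) ≤ 0)
    {η : StrongDual ℝ E} (hη : 0 < p ∨ q (A η) = 0) : θ (A η) = 0 := by
  set c := θ (A q) / q (A q)
  have hperp := hA.nonneg (θ - c • q)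
  have halong : 0 ≤ p * (θ (A q) ^ 2 / q (A q)) := by positivity
  have hsum := nonpos_of_mul_nonpos_right (apply_fluxSymbol_self hA hq θ ▸ hθ)
    (inv_sqrt_rpow_pos hq p)
  have hperp_η : (θ - c • q) (A η) = 0 := by
    have hcs := hA.sq_apply_le (θ - c • q) η
    rw [show (θ - c • q) (A (θ - c • q)) = 0 by linarith, zero_mul] at hcs
    exact pow_eq_zero_iff two_ne_zero |>.1 (hcs.antisymm (sq_nonneg _))
  have hsplit : θ (A η) = c * q (A η) := by
    simpa [sub_eq_zero] using hperp_η
  rw [hsplit]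
  rcases hη with hp | hη
  · have hθq : θ (A q) ^ 2 / q (A q) = 0 :=
      (mul_eq_zero.1 (show p * (θ (A q) ^ 2 / q (A q)) = 0 by linarith)).resolve_left hp.ne'
    have : θ (A q) = 0 := by simpa [hq.ne'] using hθq
    simp [c, this]
  · rw [hη, mul_zero]

theorem inv_sqrt_rpow {s : ℝ} (hs : 0 < s) (p : ℝ) : (√s ^ (1 - p))⁻¹ = s ^ ((p - 1) / 2) := by
  rw [Real.sqrt_eq_rpow, ← Real.rpow_mul hs.le, ← Real.rpow_neg hs.le]
  congr 1
  ring

theorem hasFDerivAt_flux (hA : IsNonnegForm A) (hq : 0 < q (A q)) :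
    HasFDerivAt (flux p A) (fluxSymbol p A q) q := by
  have hnorm : HasFDerivAt (fun q : StrongDual ℝ E => q (A q))
      ((2 : ℝ) • ContinuousLinearMap.apply ℝ ℝ (A q)) q := by
    refine ((hasFDerivAt_id q).clm_apply A.hasFDerivAt).congr_fderiv ?_
    ext η
    simp [hA.symm q η, two_mul]
  have hfactor : HasFDerivAt (fun q : StrongDual ℝ E => (√(q (A q)) ^ (1 - p))⁻¹)
      (((√(q (A q)) ^ (1 - p))⁻¹ * ((p - 1) / q (A q))) • ContinuousLinearMap.apply ℝ ℝ (A q))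
      q := by
    refine ((hnorm.rpow_const (p := (p - 1) / 2) (Or.inl hq.ne')).congr_of_eventuallyEq
      ?_).congr_fderiv ?_
    · filter_upwards [hnorm.continuousAt.eventually_const_lt hq] with q' hq'
      exact inv_sqrt_rpow hq' p
    · rw [inv_sqrt_rpow hq, Real.rpow_sub_one hq.ne', smul_smul]
      congr 1
      ring
  refine (hfactor.smul A.hasFDerivAt).congr_fderiv ?_
  ext1 η
  simp only [fluxSymbol_apply, add_apply, smul_apply, ContinuousLinearMap.smulRight_apply,
    ContinuousLinearMap.apply_apply, smul_eq_mul]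
  module

variable {X : Type*} [NormedAddCommGroup X] [NormedSpace ℝ X] {k : WithTop ℕ∞}
  {G : X → StrongDual ℝ E →L[ℝ] E} {θ : X → StrongDual ℝ E} {x : X}

theorem contDiffAt_inv_sqrt_rpow {f : X → ℝ} (hf : ContDiffAt ℝ k f x) (hx : 0 < f x) (p : ℝ) :
    ContDiffAt ℝ k (fun x => (√(f x) ^ (1 - p))⁻¹) x :=
  ((hf.sqrt hx.ne').rpow_const_of_ne (Real.sqrt_pos.2 hx).ne').inv
    (Real.rpow_pos_of_pos (Real.sqrt_pos.2 hx) _).ne'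

theorem contDiffAt_flux (hG : ContDiffAt ℝ k G x) (hθ : ContDiffAt ℝ k θ x)
    (hx : 0 < θ x (G x (θ x))) : ContDiffAt ℝ k (fun x => flux p (G x) (θ x)) x :=
  (contDiffAt_inv_sqrt_rpow (hθ.clm_apply (hG.clm_apply hθ)) hx p).smul (hG.clm_apply hθ)

theorem continuousAt_fluxSymbol (hG : ContDiffAt ℝ 1 G x) (hθ : ContDiffAt ℝ 1 θ x)
    (hnn : ∀ᶠ y in 𝓝 x, IsNonnegForm (G y)) (hx : 0 < θ x (G x (θ x))) :
    ContinuousAt (fun x => fluxSymbol p (G x) (θ x)) x := by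
  have hflux : ContDiffAt ℝ 1 (Function.uncurry fun y => flux p (G y)) (x, θ x) :=
    contDiffAt_flux (hG.comp (x, θ x) contDiffAt_fst) contDiffAt_snd hx
  have hnorm : ContinuousAt (fun y => θ y (G y (θ y))) x :=
    hθ.continuousAt.clm_apply (hG.continuousAt.clm_apply hθ.continuousAt)
  refine (hflux.fderiv (m := 0) (hθ.of_le zero_le_one) le_rfl).continuousAt.congr ?_
  filter_upwards [hnn, hnorm.eventually_const_lt hx] with y hy hpos
  exact (hasFDerivAt_flux hy hpos).fderiv

end Flux

section Linearization

variable {E : Type*} [NormedAddCommGroup E] [NormedSpace ℝ E]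

theorem exists_le_sub_of_jet_eq {F : Type*} [NormedAddCommGroup F] [NormedSpace ℝ F]
    {L : E × ℝ × StrongDual ℝ E × F → ℝ} {φ ψ : E → ℝ} {H : E → F} {x : E}
    (hφ : ContDiffAt ℝ 1 φ x) (hψ : ContDiffAt ℝ 1 ψ x) (hH : ContinuousAt H x)
    (hφψ : ψ x = φ x) (hd : fderiv ℝ ψ x = fderiv ℝ φ x)
    (hL : ContDiffAt ℝ 1 L (x, φ x, fderiv ℝ φ x, H x)) :
    ∃ K : ℝ, ∀ᶠ y in 𝓝 x, L (y, φ y, fderiv ℝ φ y, H y) - L (y, ψ y, fderiv ℝ ψ y, H y) ≤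
      K * (‖fderiv ℝ ψ y - fderiv ℝ φ y‖ + |ψ y - φ y|) := by
  obtain ⟨K, N, hN, hK⟩ := hL.exists_lipschitzOnWith
  have hjet : ∀ {χ : E → ℝ}, ContDiffAt ℝ 1 χ x →
      ContinuousAt (fun y => (y, χ y, fderiv ℝ χ y, H y)) x := fun hχ =>
    continuousAt_id.prodMk (hχ.continuousAt.prodMk
      ((hχ.fderiv_right (m := 0) (by simp)).continuousAt.prodMk hH))
  have hNψ : N ∈ 𝓝 (x, ψ x, fderiv ℝ ψ x, H x) := by rwa [hφψ, hd]
  refine ⟨K, ?_⟩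
  filter_upwards [hjet hφ hN, hjet hψ hNψ] with y hyφ hyψ
  refine (le_abs_self _).trans ((hK.norm_sub_le hyφ hyψ).trans ?_)
  rw [norm_sub_rev]
  gcongr
  simp only [Prod.mk_sub_mk, sub_self, Prod.norm_mk, norm_zero, Real.norm_eq_abs]
  have := norm_nonneg (fderiv ℝ ψ y - fderiv ℝ φ y)
  have := abs_nonneg (ψ y - φ y)
  simp only [sup_le_iff]
  refine ⟨?_, ?_, ?_, ?_⟩ <;> linarith

theorem fderiv_comp_inr {F G : Type*} [NormedAddCommGroup F] [NormedSpace ℝ F]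
    [NormedAddCommGroup G] [NormedSpace ℝ G] {W : E × F → G} {y : E} {q : F} {L : F →L[ℝ] G}
    (hW : DifferentiableAt ℝ W (y, q)) (hL : HasFDerivAt (fun q => W (y, q)) L q) :
    fderiv ℝ W (y, q) ∘L .inr ℝ E F = L :=
  (hW.hasFDerivAt.comp q (hasFDerivAt_prodMk_right y q)).unique hL

variable {G : E → StrongDual ℝ E →L[ℝ] E} {ρ φ ψ : E → ℝ} {b : E × ℝ × StrongDual ℝ E → ℝ}
  {x : E} {p : ℝ}

theorem contDiffAt_smul_flux {k : WithTop ℕ∞} {q : StrongDual ℝ E} (hG : ContDiffAt ℝ k G x)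
    (hρ : ContDiffAt ℝ k ρ x) (hq : 0 < q (G x q)) :
    ContDiffAt ℝ k (fun w : E × StrongDual ℝ E => ρ w.1 • flux p (G w.1) w.2) (x, q) :=
  (hρ.comp (x, q) contDiffAt_fst).smul
    (contDiffAt_flux (hG.comp (x, q) contDiffAt_fst) contDiffAt_snd hq)

variable [FiniteDimensional ℝ E]

/-- The divergence of a vector field, with respect to the Lebesgue measure. -/
noncomputable def divergence (W : E → E) (y : E) : ℝ :=
  traceL (fderiv ℝ W y)

theorem divergence_comp_prodMk {F : Type*} [NormedAddCommGroup F] [NormedSpace ℝ F]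
    {W : E × F → E} {θ : E → F} {y : E} (hW : DifferentiableAt ℝ W (y, θ y))
    (hθ : DifferentiableAt ℝ θ y) :
    divergence (fun y => W (y, θ y)) y =
      traceL (fderiv ℝ W (y, θ y) ∘L .inl ℝ E F) +
        traceL ((fderiv ℝ W (y, θ y) ∘L .inr ℝ E F) ∘L fderiv ℝ θ y) := by
  have h : HasFDerivAt (fun y => W (y, θ y)) _ y :=
    hW.hasFDerivAt.comp y ((hasFDerivAt_id y).prodMk hθ.hasFDerivAt)
  rw [divergence, h.fderiv, ← map_add]
  congr 1
  ext v
  simp [← map_add]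

/-- The quasilinear operator `ρ⁻¹ div (ρ |q|^{p-1} Gq) + b` as a function of the second order jet
`(y, z, q, Q)`. -/
noncomputable def jetOperator (G : E → StrongDual ℝ E →L[ℝ] E) (ρ : E → ℝ)
    (b : E × ℝ × StrongDual ℝ E → ℝ) (p : ℝ)
    (w : E × ℝ × StrongDual ℝ E × (E →L[ℝ] StrongDual ℝ E)) : ℝ :=
  let dW := fderiv ℝ (fun w : E × StrongDual ℝ E => ρ w.1 • flux p (G w.1) w.2) (w.1, w.2.2.1)
  (ρ w.1)⁻¹ * (traceL (dW ∘L .inl ℝ E (StrongDual ℝ E)) +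
    traceL ((dW ∘L .inr ℝ E (StrongDual ℝ E)) ∘L w.2.2.2)) + b (w.1, w.2.1, w.2.2.1)

theorem contDiffAt_jetOperator {z : ℝ} {q : StrongDual ℝ E} (Q : E →L[ℝ] StrongDual ℝ E)
    (hG : ContDiffAt ℝ 2 G x) (hρ : ContDiffAt ℝ 2 ρ x) (hρx : ρ x ≠ 0) (hq : 0 < q (G x q))
    (hb : ContDiffAt ℝ 1 b (x, z, q)) : ContDiffAt ℝ 1 (jetOperator G ρ b p) (x, z, q, Q) := by
  set w : E × ℝ × StrongDual ℝ E × (E →L[ℝ] StrongDual ℝ E) := (x, z, q, Q)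
  have hdW : ContDiffAt ℝ 1 (fun w : E × ℝ × StrongDual ℝ E × (E →L[ℝ] StrongDual ℝ E) =>
      fderiv ℝ (fun w : E × StrongDual ℝ E => ρ w.1 • flux p (G w.1) w.2) (w.1, w.2.2.1)) w :=
    ((contDiffAt_smul_flux hG hρ hq).fderiv_right (m := 1) (by norm_num)).comp w
      (contDiffAt_fst.prodMk contDiffAt_snd.snd.fst)
  have hρ' : ContDiffAt ℝ 1
      (fun w : E × ℝ × StrongDual ℝ E × (E →L[ℝ] StrongDual ℝ E) => (ρ w.1)⁻¹) w :=
    ((hρ.of_le one_le_two).comp w contDiffAt_fst).inv hρx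
  refine (hρ'.mul (.add ?_ ?_)).add
    (hb.comp w (contDiffAt_fst.prodMk (contDiffAt_snd.fst.prodMk contDiffAt_snd.snd.fst)))
  · exact traceL.contDiff.contDiffAt.comp w (hdW.clm_comp contDiffAt_const)
  · exact traceL.contDiff.contDiffAt.comp w
      ((hdW.clm_comp contDiffAt_const).clm_comp contDiffAt_snd.snd.snd)

theorem jetOperator_apply {y : E} {χ : E → ℝ} (hG : ContDiffAt ℝ 2 G y) (hρ : ContDiffAt ℝ 2 ρ y)
    (hχ : ContDiffAt ℝ 2 χ y) (hq : 0 < fderiv ℝ χ y (G y (fderiv ℝ χ y))) :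
    jetOperator G ρ b p (y, χ y, fderiv ℝ χ y, fderiv ℝ (fderiv ℝ χ) y) =
      (ρ y)⁻¹ * divergence (fun y => ρ y • flux p (G y) (fderiv ℝ χ y)) y +
        b (y, χ y, fderiv ℝ χ y) := by
  rw [jetOperator, ← divergence_comp_prodMk
    ((contDiffAt_smul_flux hG hρ hq).differentiableAt two_ne_zero)
    ((hχ.fderiv_right (m := 1) (by norm_num)).differentiableAt one_ne_zero)]

theorem jetOperator_sub {y : E} {z : ℝ} {q : StrongDual ℝ E} (hA : IsNonnegForm (G y))
    (hG : ContDiffAt ℝ 2 G y) (hρ : ContDiffAt ℝ 2 ρ y) (hρy : ρ y ≠ 0) (hq : 0 < q (G y q))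
    (Q Q' : E →L[ℝ] StrongDual ℝ E) :
    jetOperator G ρ b p (y, z, q, Q) - jetOperator G ρ b p (y, z, q, Q') =
      traceL (fluxSymbol p (G y) q ∘L (Q - Q')) := by
  have hsymbol := fderiv_comp_inr ((contDiffAt_smul_flux hG hρ hq).differentiableAt two_ne_zero)
    ((hasFDerivAt_flux (p := p) hA hq).const_smul (ρ y))
  simp only [jetOperator, hsymbol, ContinuousLinearMap.smul_comp, ContinuousLinearMap.comp_sub,
    map_smul, map_sub, smul_eq_mul]
  field_simp
  ring

/-- Only the highest order term of the difference of the two quasilinear expressions is not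
controlled by the Lipschitz constant of the operator in the first order jet. -/
theorem exists_traceL_fluxSymbol_le (hG : ContDiffAt ℝ 2 G x) (hρ : ContDiffAt ℝ 2 ρ x)
    (hρx : ρ x ≠ 0) (hnn : ∀ᶠ y in 𝓝 x, IsNonnegForm (G y)) (hφ : ContDiffAt ℝ 2 φ x)
    (hψ : ContDiffAt ℝ 2 ψ x) (hφψ : ψ x = φ x) (hd : fderiv ℝ ψ x = fderiv ℝ φ x)
    (hb : ContDiffAt ℝ 1 b (x, φ x, fderiv ℝ φ x))
    (hq : 0 < fderiv ℝ φ x (G x (fderiv ℝ φ x)))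
    (hH : ∀ᶠ y in 𝓝 x,
      (ρ y)⁻¹ * divergence (fun y => ρ y • flux p (G y) (fderiv ℝ ψ y)) y +
          b (y, ψ y, fderiv ℝ ψ y) ≤
        (ρ y)⁻¹ * divergence (fun y => ρ y • flux p (G y) (fderiv ℝ φ y)) y +
          b (y, φ y, fderiv ℝ φ y)) :
    ∃ K : ℝ, ∀ᶠ y in 𝓝 x, traceL (fluxSymbol p (G y) (fderiv ℝ φ y) ∘L
      (fderiv ℝ (fderiv ℝ ψ) y - fderiv ℝ (fderiv ℝ φ) y)) ≤
        K * (‖fderiv ℝ ψ y - fderiv ℝ φ y‖ + |ψ y - φ y|) := by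
  have hφ' : ContDiffAt ℝ 1 (fderiv ℝ φ) x := hφ.fderiv_right (by norm_num)
  have hψ' : ContDiffAt ℝ 1 (fderiv ℝ ψ) x := hψ.fderiv_right (by norm_num)
  obtain ⟨K, hK⟩ := exists_le_sub_of_jet_eq (hφ.of_le one_le_two) (hψ.of_le one_le_two)
    (hψ'.fderiv_right (m := 0) le_rfl).continuousAt hφψ hd
    (contDiffAt_jetOperator (p := p) (fderiv ℝ (fderiv ℝ ψ) x) hG hρ hρx hq hb)
  have hpos : ∀ {χ : E → ℝ}, ContDiffAt ℝ 1 (fderiv ℝ χ) x →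
      0 < fderiv ℝ χ x (G x (fderiv ℝ χ x)) →
      ∀ᶠ y in 𝓝 x, 0 < fderiv ℝ χ y (G y (fderiv ℝ χ y)) := fun hχ hq =>
    (hχ.continuousAt.clm_apply (hG.continuousAt.clm_apply hχ.continuousAt)).eventually_const_lt hq
  refine ⟨K, ?_⟩
  filter_upwards [hK, hH, hnn, hG.eventually (by simp), hρ.eventually (by simp),
    hρ.continuousAt.eventually_ne hρx, hφ.eventually (by simp), hψ.eventually (by simp),
    hpos hφ' hq, hpos hψ' (by rwa [hd])] with y hK hH hA hG hρ hρy hφ hψ hqφ hqψ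
  rw [← jetOperator_apply hG hρ hφ hqφ, ← jetOperator_apply hG hρ hψ hqψ] at hH
  rw [← jetOperator_sub (z := φ y) (b := b) hA hG hρ hρy hqφ]
  linarith

end Linearization

/-! ### Coordinate expressions -/

section Chart

/-- The model space `ℝ^{m+1}` of the manifolds considered here. -/
abbrev Coords (m : ℕ) : Type := EuclideanSpace ℝ (Fin (m + 1))

variable {m : ℕ} {M : Type*} [TopologicalSpace M] [ChartedSpace (Coords m) M]

variable (m) in
/-- The preferred chart at `x₀`. -/
noncomputable abbrev chart (x₀ : M) : PartialEquiv M (Coords m) := extChartAt (𝓡 (m + 1)) x₀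

/-- The derivative of the chart at `x₀`, at the point with coordinates `y`. -/
noncomputable def chartDeriv (x₀ : M) (y : Coords m) :
    TangentSpace (𝓡 (m + 1)) ((chart m x₀).symm y) →L[ℝ] Coords m :=
  mfderiv (𝓡 (m + 1)) 𝓘(ℝ, Coords m) (chart m x₀) ((chart m x₀).symm y)

/-- The derivative of the inverse of the chart at `x₀`, at the point with coordinates `y`. -/
noncomputable def chartSymmDeriv (x₀ : M) (y : Coords m) :
    Coords m →L[ℝ] TangentSpace (𝓡 (m + 1)) ((chart m x₀).symm y) :=
  mfderiv 𝓘(ℝ, Coords m) (𝓡 (m + 1)) (chart m x₀).symm y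

/-- The bundle map `G : T*M → TM` read in the chart at `x₀`. -/
noncomputable def raiseInChart (g : CoMetric m M) (x₀ : M) (y : Coords m) :
    StrongDual ℝ (Coords m) →L[ℝ] Coords m :=
  LinearMap.toContinuousLinearMap
    { toFun := fun θ => chartDeriv x₀ y (g.G _ (θ.comp (chartDeriv x₀ y)))
      map_add' := fun θ η => by rw [ContinuousLinearMap.add_comp, map_add, map_add]
      map_smul' := fun c θ => by
        rw [ContinuousLinearMap.smul_comp, map_smul, map_smul, RingHom.id_apply] }

theorem raiseInChart_apply (g : CoMetric m M) (x₀ : M) (y : Coords m)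
    (θ : StrongDual ℝ (Coords m)) :
    raiseInChart g x₀ y θ = chartDeriv x₀ y (g.G _ (θ.comp (chartDeriv x₀ y))) :=
  rfl

theorem apply_raiseInChart (g : CoMetric m M) (x₀ : M) (y : Coords m)
    (θ η : StrongDual ℝ (Coords m)) :
    θ (raiseInChart g x₀ y η) = g.inner ((chart m x₀).symm y)
      (θ.comp (chartDeriv x₀ y)) (η.comp (chartDeriv x₀ y)) :=
  g.apply_G _ (θ.comp (chartDeriv x₀ y)) _

theorem isNonnegForm_raiseInChart (g : CoMetric m M) (x₀ : M) (y : Coords m) :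
    IsNonnegForm (raiseInChart g x₀ y) where
  symm θ η := by rw [apply_raiseInChart, apply_raiseInChart, g.symm]
  nonneg θ := by rw [apply_raiseInChart]; exact g.nonneg _ _

variable [IsManifold (𝓡 (m + 1)) ∞ M] {x₀ : M} {y : Coords m}

theorem chartDeriv_chartSymmDeriv (hy : y ∈ (chart m x₀).target) (v : Coords m) :
    chartDeriv x₀ y (chartSymmDeriv x₀ y v) = v := by
  have h := mfderiv_extChartAt_comp_mfderivWithin_extChartAt_symm (I := 𝓡 (m + 1)) hy
  rw [ModelWithCorners.range_eq_univ, mfderivWithin_univ] at h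
  exact DFunLike.congr_fun h v

theorem chartSymmDeriv_chartDeriv (hy : y ∈ (chart m x₀).target)
    (v : TangentSpace (𝓡 (m + 1)) ((chart m x₀).symm y)) :
    chartSymmDeriv x₀ y (chartDeriv x₀ y v) = v := by
  have h := mfderivWithin_extChartAt_symm_comp_mfderiv_extChartAt (I := 𝓡 (m + 1)) hy
  rw [ModelWithCorners.range_eq_univ, mfderivWithin_univ] at h
  exact DFunLike.congr_fun h v

theorem contMDiffAt_chart_symm (hy : y ∈ (chart m x₀).target) :
    ContMDiffAt 𝓘(ℝ, Coords m) (𝓡 (m + 1)) ∞ (chart m x₀).symm y :=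
  (contMDiffOn_extChartAt_symm x₀).contMDiffAt ((isOpen_extChartAt_target x₀).mem_nhds hy)

theorem contDiffAt_comp_chart_symm (hy : y ∈ (chart m x₀).target) {f : M → ℝ}
    (hf : ContMDiffAt (𝓡 (m + 1)) 𝓘(ℝ, ℝ) ∞ f ((chart m x₀).symm y)) :
    ContDiffAt ℝ ∞ (f ∘ (chart m x₀).symm) y :=
  contMDiffAt_iff_contDiffAt.1 (hf.comp y (contMDiffAt_chart_symm hy))

theorem differential_eq_comp (hy : y ∈ (chart m x₀).target) {f : M → ℝ}
    (hf : MDifferentiableAt (𝓡 (m + 1)) 𝓘(ℝ, ℝ) f ((chart m x₀).symm y)) :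
    differential f ((chart m x₀).symm y) =
      (fderiv ℝ (f ∘ (chart m x₀).symm) y).comp (chartDeriv x₀ y) := by
  have hchain : fderiv ℝ (f ∘ (chart m x₀).symm) y =
      (mfderiv (𝓡 (m + 1)) 𝓘(ℝ, ℝ) f ((chart m x₀).symm y)).comp (chartSymmDeriv x₀ y) := by
    rw [← mfderiv_eq_fderiv]
    exact mfderiv_comp y hf ((contMDiffAt_chart_symm hy).mdifferentiableAt (by simp))
  ext v
  rw [hchain]
  exact (congrArg (mfderiv (𝓡 (m + 1)) 𝓘(ℝ, ℝ) f ((chart m x₀).symm y))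
    (chartSymmDeriv_chartDeriv hy v)).symm

variable (m) in
theorem contMDiffOn_chart_coord (x₀ : M) (i : Fin (m + 1)) :
    ContMDiffOn (𝓡 (m + 1)) 𝓘(ℝ, ℝ) ∞ (fun x => chart m x₀ x i) (chart m x₀).source := by
  rw [extChartAt_source]
  exact (EuclideanSpace.proj i : Coords m →L[ℝ] ℝ).contMDiff.comp_contMDiffOn
    contMDiffOn_extChartAt

theorem differential_chart_coord (hy : y ∈ (chart m x₀).target) (i : Fin (m + 1)) :
    differential (fun x => chart m x₀ x i) ((chart m x₀).symm y) =
      (EuclideanSpace.proj i : Coords m →L[ℝ] ℝ).comp (chartDeriv x₀ y) := by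
  have hmem := (isOpen_extChartAt_source x₀).mem_nhds ((chart m x₀).map_target hy)
  have hcoord : (fun x => chart m x₀ x i) ∘ (chart m x₀).symm =ᶠ[𝓝 y]
      (EuclideanSpace.proj i : Coords m →L[ℝ] ℝ) := by
    filter_upwards [(isOpen_extChartAt_target x₀).mem_nhds hy] with z hz
    exact congrArg (· i) ((chart m x₀).right_inv hz)
  rw [differential_eq_comp hy
    (((contMDiffOn_chart_coord m x₀ i).contMDiffAt hmem).mdifferentiableAt (by simp)),
    hcoord.fderiv_eq, ContinuousLinearMap.fderiv]

theorem contDiffOn_clm_of_coord {X : Type*} [NormedAddCommGroup X] [NormedSpace ℝ X]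
    {n : ℕ} {k : WithTop ℕ∞} {s : Set X}
    {A : X → StrongDual ℝ (EuclideanSpace ℝ (Fin n)) →L[ℝ] EuclideanSpace ℝ (Fin n)}
    (hA : ∀ i j, ContDiffOn ℝ k (fun x => A x (EuclideanSpace.proj j) i) s) :
    ContDiffOn ℝ k A s := by
  have hdual (θ : StrongDual ℝ (EuclideanSpace ℝ (Fin n))) :
      θ = ∑ j, θ (EuclideanSpace.single j 1) • EuclideanSpace.proj j := by
    refine ContinuousLinearMap.coe_injective
      ((EuclideanSpace.basisFun (Fin n) ℝ).toBasis.ext fun j => ?_)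
    simp [PiLp.single_apply]
  refine contDiffOn_clm_apply.2 fun θ => contDiffOn_euclidean.2 fun i => ?_
  have hsum : (fun x => A x θ i) =
      fun x => ∑ j, θ (EuclideanSpace.single j 1) * A x (EuclideanSpace.proj j) i := by
    ext x
    conv_lhs => rw [hdual θ]
    simp
  rw [hsum]
  exact ContDiffOn.sum fun j _ => contDiffOn_const.mul (hA i j)

theorem contDiffAt_raiseInChart (g : CoMetric m M) (hy : y ∈ (chart m x₀).target) :
    ContDiffAt ℝ ∞ (raiseInChart g x₀) y := by
  suffices h : ContDiffOn ℝ ∞ (raiseInChart g x₀) (chart m x₀).target from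
    h.contDiffAt ((isOpen_extChartAt_target x₀).mem_nhds hy)
  refine contDiffOn_clm_of_coord fun i j z hz => ContDiffAt.contDiffWithinAt ?_
  have hinner := g.smooth _ _ _ (isOpen_extChartAt_source x₀) (contMDiffOn_chart_coord m x₀ i)
    (contMDiffOn_chart_coord m x₀ j)
  refine (contDiffAt_comp_chart_symm hz (hinner.contMDiffAt ((isOpen_extChartAt_source
    x₀).mem_nhds ((chart m x₀).map_target hz)))).congr_of_eventuallyEq ?_
  filter_upwards [(isOpen_extChartAt_target x₀).mem_nhds hz] with w hw
  rw [Function.comp_apply, differential_chart_coord hw, differential_chart_coord hw]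
  exact apply_raiseInChart g x₀ w (EuclideanSpace.proj i) (EuclideanSpace.proj j)

end Chart

/-! ### The mean curvature in coordinates -/

section CoordinateForms

variable {m : ℕ}

/-- The standard volume form of `ℝ^{m+1}`. -/
noncomputable def coordVolume (m : ℕ) : Coords m [⋀^Fin (m + 1)]→L[ℝ] ℝ :=
  { (EuclideanSpace.basisFun (Fin (m + 1)) ℝ).toBasis.det with
    cont := Continuous.matrix_det (continuous_matrix fun i j =>
      (EuclideanSpace.proj i : Coords m →L[ℝ] ℝ).continuous.comp (continuous_apply j)) }

theorem coordVolume_basisFun : coordVolume m (EuclideanSpace.basisFun (Fin (m + 1)) ℝ) = 1 := by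
  have h := (EuclideanSpace.basisFun (Fin (m + 1)) ℝ).toBasis.det_self
  rwa [OrthonormalBasis.coe_toBasis] at h

theorem eq_smul_coordVolume (α : Coords m [⋀^Fin (m + 1)]→L[ℝ] ℝ) :
    α = α (EuclideanSpace.basisFun (Fin (m + 1)) ℝ) • coordVolume m := by
  apply ContinuousAlternatingMap.toAlternatingMap_injective
  have h := α.toAlternatingMap.eq_smul_basis_det (EuclideanSpace.basisFun (Fin (m + 1)) ℝ).toBasis
  rwa [OrthonormalBasis.coe_toBasis] at h

theorem alternatizeUncurryFin_curryLeft_comp_smulRight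
    (α : Coords m [⋀^Fin (m + 1)]→L[ℝ] ℝ) (θ : StrongDual ℝ (Coords m)) (v : Coords m) :
    ContinuousAlternatingMap.alternatizeUncurryFin (α.curryLeft ∘L θ.smulRight v) = θ v • α := by
  apply ContinuousAlternatingMap.toAlternatingMap_injective
  rw [ContinuousAlternatingMap.toAlternatingMap_smul,
    ContinuousAlternatingMap.toAlternatingMap_alternatizeUncurryFin]
  refine Eq.trans ?_ (wedge_contract (M := Coords m) (x := (0 : Coords m)) θ v α)
  congr 1
  ext w u
  change α.curryLeft (θ w • v) u = θ w • α.curryLeft v u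
  rw [map_smul]
  rfl

theorem alternatizeUncurryFin_curryLeft_comp (α : Coords m [⋀^Fin (m + 1)]→L[ℝ] ℝ)
    (L : Coords m →L[ℝ] Coords m) :
    ContinuousAlternatingMap.alternatizeUncurryFin (α.curryLeft ∘L L) = traceL L • α := by
  have hL : L = ∑ i, ((EuclideanSpace.proj i : StrongDual ℝ (Coords m)) ∘L L).smulRight
      (EuclideanSpace.single i 1) := by
    ext v i
    simp [Pi.single_apply]
  rw [hL, ContinuousLinearMap.comp_finsetSum, map_sum, Finset.sum_smul,
    ← ContinuousAlternatingMap.alternatizeUncurryFinCLM_apply, map_sum]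
  refine Finset.sum_congr rfl fun i _ => ?_
  rw [traceL_smulRight, ContinuousAlternatingMap.alternatizeUncurryFinCLM_apply,
    alternatizeUncurryFin_curryLeft_comp_smulRight]

theorem extDeriv_curryLeft (α : Coords m [⋀^Fin (m + 1)]→L[ℝ] ℝ) {V : Coords m → Coords m}
    {y : Coords m} (hV : DifferentiableAt ℝ V y) :
    extDeriv (fun y => α.curryLeft (V y)) y = divergence V y • α := by
  have hd : HasFDerivAt (fun y => α.curryLeft (V y)) (α.curryLeft ∘L fderiv ℝ V y) y :=
    α.curryLeft.hasFDerivAt.comp y hV.hasFDerivAt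
  rw [extDeriv, hd.fderiv, alternatizeUncurryFin_curryLeft_comp, divergence]

end CoordinateForms

section FormInChart

theorem two_le_smooth : (2 : WithTop ℕ∞) ≤ ∞ :=
  WithTop.coe_le_coe.2 le_top

variable {m : ℕ} {M : Type*} [TopologicalSpace M] [ChartedSpace (Coords m) M]

theorem Form.inChart_apply {k : ℕ} (θ : Form m M k) (x₀ : M) (y : Coords m)
    (u : Fin k → Coords m) :
    θ.inChart x₀ y u = θ ((chart m x₀).symm y) fun i => chartSymmDeriv x₀ y (u i) :=
  rfl

variable [IsManifold (𝓡 (m + 1)) ∞ M] {x₀ x₁ : M} {y : Coords m}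

theorem contMDiffAt_transition (hy : y ∈ (chart m x₀).target)
    (hx : (chart m x₀).symm y ∈ (chart m x₁).source) :
    ContMDiffAt 𝓘(ℝ, Coords m) 𝓘(ℝ, Coords m) ∞ (chart m x₁ ∘ (chart m x₀).symm) y :=
  (contMDiffAt_extChartAt' (by rwa [extChartAt_source] at hx)).comp y (contMDiffAt_chart_symm hy)

theorem eventually_mem_chart_overlap (hy : y ∈ (chart m x₀).target)
    (hx : (chart m x₀).symm y ∈ (chart m x₁).source) :
    ∀ᶠ z in 𝓝 y, z ∈ (chart m x₀).target ∧ (chart m x₀).symm z ∈ (chart m x₁).source :=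
  ((isOpen_extChartAt_target x₀).eventually_mem hy).and
    ((contMDiffAt_chart_symm hy).continuousAt.eventually_mem
      ((isOpen_extChartAt_source x₁).mem_nhds hx))

theorem chartSymmDeriv_apply_eq_transition (hy : y ∈ (chart m x₀).target)
    (hx : (chart m x₀).symm y ∈ (chart m x₁).source) (v : Coords m) :
    (chartSymmDeriv x₀ y v : Coords m) =
      chartSymmDeriv x₁ (chart m x₁ ((chart m x₀).symm y))
        (fderiv ℝ (chart m x₁ ∘ (chart m x₀).symm) y v) := by
  have hcomp := mfderiv_comp y
    ((contMDiffAt_chart_symm ((chart m x₁).map_source hx)).mdifferentiableAt (by simp))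
    ((contMDiffAt_transition hy hx).mdifferentiableAt (by simp))
  have hsymm : (chart m x₀).symm =ᶠ[𝓝 y]
      (chart m x₁).symm ∘ chart m x₁ ∘ (chart m x₀).symm := by
    filter_upwards [eventually_mem_chart_overlap hy hx] with z hz
    exact ((chart m x₁).left_inv hz.2).symm
  rw [mfderiv_eq_fderiv] at hcomp
  exact DFunLike.congr_fun (hsymm.mfderiv_eq.trans hcomp) v

theorem Form.inChart_eq_pullback {k : ℕ} (θ : Form m M k) (hy : y ∈ (chart m x₀).target)
    (hx : (chart m x₀).symm y ∈ (chart m x₁).source) :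
    θ.inChart x₀ y = (θ.inChart x₁ ((chart m x₁ ∘ (chart m x₀).symm) y)).compContinuousLinearMap
      (fderiv ℝ (chart m x₁ ∘ (chart m x₀).symm) y) := by
  have hcongr {x x' : M} (h : x = x') {v v' : Fin k → Coords m} (hv : v = v') :
      θ x v = θ x' v' := by rw [h, hv]
  ext u
  exact hcongr ((chart m x₁).left_inv hx).symm
    (funext fun i => chartSymmDeriv_apply_eq_transition hy hx (u i))

theorem Form.extDeriv_inChart {k : ℕ} (θ : Form m M k) (hy : y ∈ (chart m x₀).target)
    (hθ : DifferentiableAt ℝ (θ.inChart ((chart m x₀).symm y))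
      (chart m ((chart m x₀).symm y) ((chart m x₀).symm y))) :
    θ.extDeriv.inChart x₀ y = _root_.extDeriv (θ.inChart x₀) y := by
  let x := (chart m x₀).symm y
  have hx : x ∈ (chart m x).source := mem_extChartAt_source x
  have hderiv : fderiv ℝ (chart m x ∘ (chart m x₀).symm) y =
      (mfderiv (𝓡 (m + 1)) 𝓘(ℝ, Coords m) (chart m x) x).comp (chartSymmDeriv x₀ y) := by
    rw [← mfderiv_eq_fderiv]
    exact mfderiv_comp y (mdifferentiableAt_extChartAt (mem_chart_source _ x))
      ((contMDiffAt_chart_symm hy).mdifferentiableAt (by simp))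
  have hpull : θ.inChart x₀ =ᶠ[𝓝 y] _ := (eventually_mem_chart_overlap hy hx).mono fun z hz =>
    θ.inChart_eq_pullback hz.1 hz.2
  rw [hpull.extDeriv_eq, extDeriv_pullback (f := chart m x ∘ (chart m x₀).symm) hθ
    (contMDiffAt_transition hy hx).contDiffAt (by simp [two_le_smooth]), hderiv]
  rfl

end FormInChart

section MeanCurvature

variable {m : ℕ} {M : Type*} [TopologicalSpace M] [ChartedSpace (Coords m) M]

/-- The density of the volume form with respect to the standard one, in the chart at `x₀`. -/
noncomputable def density (dv : VolumeForm m M) (x₀ : M) (y : Coords m) : ℝ :=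
  dv.form.inChart x₀ y (EuclideanSpace.basisFun (Fin (m + 1)) ℝ)

/-- The vector field `|dφ|_*^{p-1} G(dφ)`, read in the chart at `x₀`. -/
noncomputable def fluxInChart (g : CoMetric m M) (p : ℝ) (φ : M → ℝ) (x₀ : M) (y : Coords m) :
    Coords m :=
  flux p (raiseInChart g x₀ y) (fderiv ℝ (φ ∘ (chart m x₀).symm) y)

theorem inChart_eq_density_smul (dv : VolumeForm m M) (x₀ : M) (y : Coords m) :
    dv.form.inChart x₀ y = density dv x₀ y • coordVolume m :=
  eq_smul_coordVolume _

variable {x₀ : M} {y : Coords m}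

theorem contDiffAt_density (dv : VolumeForm m M) (hy : y ∈ (chart m x₀).target) :
    ContDiffAt ℝ ∞ (density dv x₀) y :=
  (ContinuousAlternatingMap.apply ℝ (Coords m) ℝ
    (EuclideanSpace.basisFun (Fin (m + 1)) ℝ)).contDiff.contDiffAt.comp y
      ((dv.smooth x₀).contDiffAt ((isOpen_extChartAt_target x₀).mem_nhds hy))

variable [IsManifold (𝓡 (m + 1)) ∞ M]

theorem density_ne_zero (dv : VolumeForm m M) (hy : y ∈ (chart m x₀).target) :
    density dv x₀ y ≠ 0 := by
  intro h0
  refine dv.ne_zero ((chart m x₀).symm y) (ContinuousAlternatingMap.ext fun u => ?_)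
  have hzero : dv.form.inChart x₀ y (fun i => chartDeriv x₀ y (u i)) = 0 := by
    rw [inChart_eq_density_smul, h0, zero_smul]
    rfl
  rw [Form.inChart_apply] at hzero
  simp only [chartSymmDeriv_chartDeriv hy] at hzero
  exact hzero

theorem norm_differential (g : CoMetric m M) (hy : y ∈ (chart m x₀).target) {φ : M → ℝ}
    (hφ : MDifferentiableAt (𝓡 (m + 1)) 𝓘(ℝ, ℝ) φ ((chart m x₀).symm y)) :
    g.norm (differential φ ((chart m x₀).symm y)) =
      √(fderiv ℝ (φ ∘ (chart m x₀).symm) y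
        (raiseInChart g x₀ y (fderiv ℝ (φ ∘ (chart m x₀).symm) y))) := by
  rw [CoMetric.norm, differential_eq_comp hy hφ, apply_raiseInChart]

theorem chartDeriv_G_normalized_differential (g : CoMetric m M) (p : ℝ)
    (hy : y ∈ (chart m x₀).target) {φ : M → ℝ}
    (hφ : MDifferentiableAt (𝓡 (m + 1)) 𝓘(ℝ, ℝ) φ ((chart m x₀).symm y)) :
    chartDeriv x₀ y (g.G _ ((g.norm (differential φ ((chart m x₀).symm y)) ^ (1 - p))⁻¹ •
      differential φ ((chart m x₀).symm y))) = fluxInChart g p φ x₀ y := by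
  rw [norm_differential g hy hφ, map_smul, map_smul, differential_eq_comp hy hφ,
    ← raiseInChart_apply]
  rfl

theorem areaForm_inChart (g : CoMetric m M) (dv : VolumeForm m M) (p : ℝ)
    (hy : y ∈ (chart m x₀).target) {φ : M → ℝ}
    (hφ : MDifferentiableAt (𝓡 (m + 1)) 𝓘(ℝ, ℝ) φ ((chart m x₀).symm y)) :
    (g.areaForm dv p φ).inChart x₀ y =
      (coordVolume m).curryLeft (density dv x₀ y • fluxInChart g p φ x₀ y) := by
  rw [map_smul, ← smul_apply, ← ContinuousAlternatingMap.curryLeft_smul,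
    ← inChart_eq_density_smul, ← chartDeriv_G_normalized_differential g p hy hφ]
  ext u
  rw [ContinuousAlternatingMap.curryLeft_apply_apply, Form.inChart_apply, Form.inChart_apply]
  refine congrArg (dv.form _) (funext fun i => ?_)
  refine Fin.cases ?_ (fun i => rfl) i
  exact (chartSymmDeriv_chartDeriv hy _).symm

theorem areaForm_inChart_eventuallyEq (g : CoMetric m M) (dv : VolumeForm m M) (p : ℝ)
    (hy : y ∈ (chart m x₀).target) {φ : M → ℝ}
    (hφ : ContMDiffAt (𝓡 (m + 1)) 𝓘(ℝ, ℝ) ∞ φ ((chart m x₀).symm y)) :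
    (g.areaForm dv p φ).inChart x₀ =ᶠ[𝓝 y] fun z =>
      (coordVolume m).curryLeft (density dv x₀ z • fluxInChart g p φ x₀ z) := by
  have hnear : ∀ᶠ x in 𝓝 ((chart m x₀).symm y), ContMDiffAt (𝓡 (m + 1)) 𝓘(ℝ, ℝ) 1 φ x :=
    (contMDiffAt_iff_contMDiffAt_nhds (by simp)).1 (hφ.of_le (by simp))
  filter_upwards [(contMDiffAt_chart_symm hy).continuousAt.eventually hnear,
    (isOpen_extChartAt_target x₀).mem_nhds hy] with z hφz hz
  exact areaForm_inChart g dv p hz (hφz.mdifferentiableAt (by simp))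

theorem differentiableAt_density_smul_fluxInChart (g : CoMetric m M) (dv : VolumeForm m M) (p : ℝ)
    (hy : y ∈ (chart m x₀).target) {φ : M → ℝ}
    (hφ : ContMDiffAt (𝓡 (m + 1)) 𝓘(ℝ, ℝ) ∞ φ ((chart m x₀).symm y))
    (hφ0 : g.norm (differential φ ((chart m x₀).symm y)) ≠ 0) :
    DifferentiableAt ℝ (fun z => density dv x₀ z • fluxInChart g p φ x₀ z) y := by
  rw [norm_differential g hy (hφ.mdifferentiableAt (by simp))] at hφ0
  have hflux := contDiffAt_flux (p := p) (contDiffAt_raiseInChart g hy)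
    ((contDiffAt_comp_chart_symm hy hφ).fderiv_right (m := ∞) (by simp)) (Real.sqrt_ne_zero'.1 hφ0)
  exact ((contDiffAt_density dv hy).smul hflux).differentiableAt (by simp)

theorem extDeriv_areaForm_inChart (g : CoMetric m M) (dv : VolumeForm m M) (p : ℝ)
    (hy : y ∈ (chart m x₀).target) {φ : M → ℝ}
    (hφ : ContMDiffAt (𝓡 (m + 1)) 𝓘(ℝ, ℝ) ∞ φ ((chart m x₀).symm y))
    (hφ0 : g.norm (differential φ ((chart m x₀).symm y)) ≠ 0) :
    (g.areaForm dv p φ).extDeriv.inChart x₀ y =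
      divergence (fun z => density dv x₀ z • fluxInChart g p φ x₀ z) y • coordVolume m := by
  let x := (chart m x₀).symm y
  have hinv : (chart m x).symm (chart m x x) = x := extChartAt_to_inv x
  have hx := mem_extChartAt_target (I := 𝓡 (m + 1)) x
  have hdiff : DifferentiableAt ℝ ((g.areaForm dv p φ).inChart x) (chart m x x) :=
    ((coordVolume m).curryLeft.differentiableAt.comp _
      (differentiableAt_density_smul_fluxInChart g dv p hx (by rwa [hinv]) (by rwa [hinv]))
      ).congr_of_eventuallyEq (areaForm_inChart_eventuallyEq g dv p hx (by rwa [hinv]))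
  rw [Form.extDeriv_inChart _ hy hdiff,
    (areaForm_inChart_eventuallyEq g dv p hy hφ).extDeriv_eq,
    extDeriv_curryLeft _ (differentiableAt_density_smul_fluxInChart g dv p hy hφ hφ0)]

theorem meanCurvature_eq (g : CoMetric m M) (dv : VolumeForm m M) (p : ℝ)
    (hy : y ∈ (chart m x₀).target) {φ : M → ℝ}
    (hφ : ContMDiffAt (𝓡 (m + 1)) 𝓘(ℝ, ℝ) ∞ φ ((chart m x₀).symm y))
    (hφ0 : g.norm (differential φ ((chart m x₀).symm y)) ≠ 0) :
    g.meanCurvature dv p φ ((chart m x₀).symm y) = (density dv x₀ y)⁻¹ *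
      divergence (fun z => density dv x₀ z • fluxInChart g p φ x₀ z) y := by
  have hform : (g.areaForm dv p φ).extDeriv.inChart x₀ y =
      g.meanCurvature dv p φ ((chart m x₀).symm y) • dv.form.inChart x₀ y := by
    ext u
    rw [Form.inChart_apply, g.extDeriv_areaForm dv p φ]
    rfl
  rw [extDeriv_areaForm_inChart g dv p hy hφ hφ0, inChart_eq_density_smul, smul_smul] at hform
  have hval := congrArg (fun α => α (EuclideanSpace.basisFun (Fin (m + 1)) ℝ)) hform
  simp only [ContinuousAlternatingMap.smul_apply, coordVolume_basisFun, smul_eq_mul,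
    mul_one] at hval
  rw [hval, mul_comm, mul_inv_cancel_right₀ (density_ne_zero dv hy)]

end MeanCurvature

/-! ### Lie modules of vector fields in coordinates -/

section IsLieClosed

variable {E : Type*} [NormedAddCommGroup E] [NormedSpace ℝ E]

/-- Properties of vector fields on `O` which define a module over the functions on `O`, closed under
Lie brackets of smooth fields. It is used to transfer a property of `X₁, …, X_r` to all of
`£(X₁, …, X_r)`. -/
structure IsLieClosed (O : Set E) (P : (E → E) → Prop) : Prop where
  congr : ∀ {V W}, P V → EqOn V W O → P W
  zero : P 0
  add : ∀ {V W}, P V → P W → P (V + W)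
  smul : ∀ {V}, P V → ∀ f : E → ℝ, P fun y => f y • V y
  lieBracket : ∀ {V W}, P V → P W → ContDiffOn ℝ ∞ V O → ContDiffOn ℝ ∞ W O →
    P (VectorField.lieBracket ℝ V W)

end IsLieClosed

theorem isLieClosed_tangentTo {E : Type*} [NormedAddCommGroup E] [InnerProductSpace ℝ E]
    [ProperSpace E] {F O : Set E} (hF : IsClosed F) (hO : IsOpen O) :
    IsLieClosed O (TangentTo F O) where
  congr hV hVW := hV.congr (hVW.mono inter_subset_right)
  zero := .zero
  add hV hW := hV.add hW
  smul hV f := hV.smul f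
  lieBracket hV hW hVs hWs :=
    hV.lieBracket hF hO hW (hVs.of_le two_le_smooth) (hWs.of_le two_le_smooth)

section LevelSet

variable {E : Type*} [NormedAddCommGroup E] [NormedSpace ℝ E] [CompleteSpace E]
  {f h : E → ℝ} {V W : E → E} {x v : E} {O : Set E}

theorem fderiv_apply_eq_zero_of_eq_zero_on_levelSet (hf : ContDiffAt ℝ 1 f x)
    (hh : ContDiffAt ℝ 1 h x) (hfx : f x = 0) (hfh : ∀ᶠ y in 𝓝 x, f y = 0 → h y = 0)
    (hdf : fderiv ℝ f x ≠ 0) (hv : fderiv ℝ f x v = 0) : fderiv ℝ h x v = 0 := by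
  have hext : IsLocalExtrOn h {y | f y = f x} x := by
    left
    rw [IsMinFilter, eventually_nhdsWithin_iff]
    filter_upwards [hfh] with y hy hyf
    rw [hy (hyf.trans hfx), hfh.self_of_nhds hfx]
  obtain ⟨a, b, hab, hmul⟩ := hext.exists_multipliers_of_hasStrictFDerivAt_1d
    (hf.hasStrictFDerivAt (by simp)) (hh.hasStrictFDerivAt (by simp))
  have hb : b ≠ 0 := by
    rintro rfl
    simp only [zero_smul, add_zero, smul_eq_zero, hdf, or_false] at hmul
    exact hab (Prod.ext hmul rfl)
  simpa [hv, hb] using DFunLike.congr_fun hmul v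

/-- Differentiate `df(W) = 0` along `f = 0` in the direction `V`. -/
theorem fderiv_fderiv_apply_of_tangent_levelSet (hf : ContDiffAt ℝ 2 f x)
    (hW : ContDiffAt ℝ 1 W x) (hfx : f x = 0) (hdf : fderiv ℝ f x ≠ 0)
    (hfW : ∀ᶠ y in 𝓝 x, f y = 0 → fderiv ℝ f y (W y) = 0) (hfv : fderiv ℝ f x v = 0) :
    fderiv ℝ f x (fderiv ℝ W x v) = -fderiv ℝ (fderiv ℝ f) x v (W x) := by
  have hf' : ContDiffAt ℝ 1 (fderiv ℝ f) x := hf.fderiv_right (by norm_num)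
  have hzero := fderiv_apply_eq_zero_of_eq_zero_on_levelSet (hf.of_le (by norm_num))
    (hf'.clm_apply hW) hfx hfW hdf hfv
  rw [fderiv_clm_apply (hf'.differentiableAt (by simp)) (hW.differentiableAt (by simp))] at hzero
  exact eq_neg_of_add_eq_zero_left hzero

theorem fderiv_lieBracket_eq_zero (hf : ContDiffAt ℝ 2 f x) (hV : ContDiffAt ℝ 1 V x)
    (hW : ContDiffAt ℝ 1 W x) (hfx : f x = 0) (hdf : fderiv ℝ f x ≠ 0)
    (hfV : ∀ᶠ y in 𝓝 x, f y = 0 → fderiv ℝ f y (V y) = 0)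
    (hfW : ∀ᶠ y in 𝓝 x, f y = 0 → fderiv ℝ f y (W y) = 0) :
    fderiv ℝ f x (VectorField.lieBracket ℝ V W x) = 0 := by
  have hsymm : IsSymmSndFDerivAt ℝ f x := hf.isSymmSndFDerivAt (by simp)
  rw [VectorField.lieBracket_eq, map_sub,
    fderiv_fderiv_apply_of_tangent_levelSet hf hW hfx hdf hfW (hfV.self_of_nhds hfx),
    fderiv_fderiv_apply_of_tangent_levelSet hf hV hfx hdf hfV (hfW.self_of_nhds hfx),
    hsymm (V x) (W x), sub_self]

theorem isLieClosed_fderiv_apply_eq_zero (hO : IsOpen O) (hf : ContDiffOn ℝ 2 f O)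
    (hdf : ∀ y ∈ O, fderiv ℝ f y ≠ 0) :
    IsLieClosed O fun V => ∀ y ∈ O, f y = 0 → fderiv ℝ f y (V y) = 0 where
  congr hV hVW y hy hfy := by rw [← hVW hy, hV y hy hfy]
  zero y _ _ := by simp
  add hV hW y hy hfy := by rw [Pi.add_apply, map_add, hV y hy hfy, hW y hy hfy, add_zero]
  smul hV c y hy hfy := by rw [map_smul, hV y hy hfy, smul_zero]
  lieBracket hV hW hVs hWs y hy hfy :=
    have hOy := hO.mem_nhds hy
    fderiv_lieBracket_eq_zero (hf.contDiffAt hOy) ((hVs.contDiffAt hOy).of_le (by simp))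
      ((hWs.contDiffAt hOy).of_le (by simp)) hfy (hdf y hy) (mem_of_superset hOy hV)
      (mem_of_superset hOy hW)

end LevelSet

section FieldInChart

variable {m : ℕ} {M : Type*} [TopologicalSpace M] [ChartedSpace (Coords m) M]

/-- A vector field read in the chart at `x₀`. -/
noncomputable def fieldInChart (x₀ : M) (Z : Π x : M, TangentSpace (𝓡 (m + 1)) x) :
    Coords m → Coords m :=
  VectorField.mpullback 𝓘(ℝ, Coords m) (𝓡 (m + 1)) (chart m x₀).symm Z

variable [IsManifold (𝓡 (m + 1)) ∞ M] {x₀ : M} {y : Coords m}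
  {Z V W : Π x : M, TangentSpace (𝓡 (m + 1)) x}

/-- The derivative of the inverse chart as an isomorphism. -/
noncomputable def chartSymmDerivEquiv (hy : y ∈ (chart m x₀).target) :
    Coords m ≃L[ℝ] TangentSpace (𝓡 (m + 1)) ((chart m x₀).symm y) :=
  ContinuousLinearEquiv.equivOfInverse (chartSymmDeriv x₀ y) (chartDeriv x₀ y)
    (chartDeriv_chartSymmDeriv hy) (chartSymmDeriv_chartDeriv hy)

theorem fieldInChart_apply (hy : y ∈ (chart m x₀).target)
    (Z : Π x : M, TangentSpace (𝓡 (m + 1)) x) :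
    fieldInChart x₀ Z y = chartDeriv x₀ y (Z ((chart m x₀).symm y)) :=
  DFunLike.congr_fun (ContinuousLinearMap.inverse_equiv (chartSymmDerivEquiv hy)) _

theorem contDiffAt_fieldInChart (hy : y ∈ (chart m x₀).target)
    (hZ : ContMDiffAt (𝓡 (m + 1)) (𝓡 (m + 1)).tangent ∞
      (fun x => (⟨x, Z x⟩ : TangentBundle (𝓡 (m + 1)) M)) ((chart m x₀).symm y)) :
    ContDiffAt ℝ ∞ (fieldInChart x₀ Z) y := by
  have : IsManifold (𝓡 (m + 1)) 1 M := .of_le (n := ∞) (by simp)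
  exact contMDiffAt_vectorSpace_iff_contDiffAt.1
    (hZ.mpullback_vectorField_preimage (contMDiffAt_chart_symm hy) ⟨chartSymmDerivEquiv hy, rfl⟩
      (by simp))

theorem fieldInChart_mlieBracket (hy : y ∈ (chart m x₀).target)
    (hV : ContMDiffAt (𝓡 (m + 1)) (𝓡 (m + 1)).tangent ∞
      (fun x => (⟨x, V x⟩ : TangentBundle (𝓡 (m + 1)) M)) ((chart m x₀).symm y))
    (hW : ContMDiffAt (𝓡 (m + 1)) (𝓡 (m + 1)).tangent ∞
      (fun x => (⟨x, W x⟩ : TangentBundle (𝓡 (m + 1)) M)) ((chart m x₀).symm y)) :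
    fieldInChart x₀ (VectorField.mlieBracket (𝓡 (m + 1)) V W) y =
      VectorField.lieBracket ℝ (fieldInChart x₀ V) (fieldInChart x₀ W) y := by
  have hmin : minSmoothness ℝ 2 ≤ ∞ := by simp [two_le_smooth]
  have : IsManifold (𝓡 (m + 1)) (minSmoothness ℝ 2) M := .of_le (n := ∞) hmin
  refine (VectorField.mpullback_mlieBracket (hV.mdifferentiableAt (by simp))
    (hW.mdifferentiableAt (by simp)) (contMDiffAt_chart_symm hy) hmin).trans ?_
  rw [← VectorField.mlieBracketWithin_univ, VectorField.mlieBracketWithin_eq_lieBracketWithin]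
  exact congrFun VectorField.lieBracketWithin_univ y

variable {U : Set M} {r : ℕ} {X : Fin r → Π x : M, TangentSpace (𝓡 (m + 1)) x}

theorem LieSpan.contMDiffAt (hU : IsOpen U) (hX : ∀ i, SmoothFieldOn U (X i))
    (hZ : LieSpan U X Z) {x : M} (hx : x ∈ U) :
    ContMDiffAt (𝓡 (m + 1)) (𝓡 (m + 1)).tangent ∞
      (fun x => (⟨x, Z x⟩ : TangentBundle (𝓡 (m + 1)) M)) x := by
  have : IsManifold (𝓡 (m + 1)) (minSmoothness ℝ 2) M :=
    .of_le (n := ∞) (by simp [two_le_smooth])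
  have : IsManifold (𝓡 (m + 1)) (((⊤ : ℕ∞) : WithTop ℕ∞) + 1) M := by simpa
  induction hZ with
  | gen i => exact (hX i).contMDiffAt (hU.mem_nhds hx)
  | zero => exact (Bundle.contMDiff_zeroSection ℝ (TangentSpace (𝓡 (m + 1)) (M := M))).contMDiffAt
  | add _ _ hV hW => exact hV.add_section hW
  | smul f hf _ hV => exact (hf.contMDiffAt (hU.mem_nhds hx)).smul_section hV
  | bracket _ _ hV hW => exact hV.mlieBracket_vectorField hW (by simp)

theorem IsLieClosed.of_lieSpan {O : Set (Coords m)} {P : (Coords m → Coords m) → Prop}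
    (hP : IsLieClosed O P) (hU : IsOpen U) (hX : ∀ i, SmoothFieldOn U (X i))
    (hO : ∀ y ∈ O, y ∈ (chart m x₀).target ∧ (chart m x₀).symm y ∈ U)
    (hgen : ∀ i, P (fieldInChart x₀ (X i))) (hZ : LieSpan U X Z) : P (fieldInChart x₀ Z) := by
  induction hZ with
  | gen i => exact hgen i
  | zero =>
    refine hP.congr hP.zero fun y hy => ?_
    rw [fieldInChart_apply (hO y hy).1]
    exact (map_zero _).symm
  | add _ _ hV hW =>
    refine hP.congr (hP.add hV hW) fun y hy => ?_
    simp only [Pi.add_apply, fieldInChart_apply (hO y hy).1]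
    exact (map_add _ _ _).symm
  | smul f _ _ hV =>
    refine hP.congr (hP.smul hV (f ∘ (chart m x₀).symm)) fun y hy => ?_
    simp only [Function.comp_apply, fieldInChart_apply (hO y hy).1]
    exact (map_smul _ _ _).symm
  | bracket hV hW hPV hPW =>
    have hsmooth {Z} (hZ : LieSpan U X Z) : ContDiffOn ℝ ∞ (fieldInChart x₀ Z) O := fun y hy =>
      (contDiffAt_fieldInChart (hO y hy).1 (hZ.contMDiffAt hU hX (hO y hy).2)).contDiffWithinAt
    exact hP.congr (hP.lieBracket hPV hPW (hsmooth hV) (hsmooth hW)) fun y hy =>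
      (fieldInChart_mlieBracket (hO y hy).1 (hV.contMDiffAt hU hX (hO y hy).2)
        (hW.contMDiffAt hU hX (hO y hy).2)).symm

/-- The span of `£(X₁, …, X_r)` at a point, in the coordinates of the chart at `x₀`. -/
noncomputable def lieSpanInChart (x₀ : M) (U : Set M)
    (X : Fin r → Π x : M, TangentSpace (𝓡 (m + 1)) x) (y : Coords m) : Submodule ℝ (Coords m) :=
  Submodule.span ℝ ((fieldInChart x₀ · y) '' {Z | LieSpan U X Z})

theorem finrank_lieSpanInChart (hy : y ∈ (chart m x₀).target) (U : Set M)
    (X : Fin r → Π x : M, TangentSpace (𝓡 (m + 1)) x) :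
    Module.finrank ℝ (lieSpanInChart x₀ U X y) = lieRank U X ((chart m x₀).symm y) := by
  have hmap : lieSpanInChart x₀ U X y = (Submodule.span ℝ {v | ∃ Z, LieSpan U X Z ∧
      Z ((chart m x₀).symm y) = v}).map
        ((chartSymmDerivEquiv hy).symm.toLinearEquiv : _ →ₗ[ℝ] Coords m) := by
    rw [Submodule.map_span, lieSpanInChart]
    congr 1
    ext v
    constructor
    · rintro ⟨Z, hZ, rfl⟩
      exact ⟨_, ⟨Z, hZ, rfl⟩, (fieldInChart_apply hy Z).symm⟩
    · rintro ⟨_, ⟨Z, hZ, rfl⟩, rfl⟩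
      exact ⟨Z, hZ, fieldInChart_apply hy Z⟩
  rw [hmap, lieRank]
  exact LinearEquiv.finrank_map_eq _ _

end FieldInChart

/-! ### The contact set -/

section ContactSet

section FirstOrderContact

variable {E : Type*} [NormedAddCommGroup E] [NormedSpace ℝ E] {φ ψ : E → ℝ} {x : E}

theorem fderiv_eq_of_le_of_eq (hφ : DifferentiableAt ℝ φ x) (hψ : DifferentiableAt ℝ ψ x)
    (hle : ∀ᶠ y in 𝓝 x, φ y ≤ ψ y) (hx : ψ x = φ x) : fderiv ℝ ψ x = fderiv ℝ φ x := by
  have hmin : IsLocalMin (ψ - φ) x := by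
    filter_upwards [hle] with y hy
    simpa only [Pi.sub_apply, hx, sub_self, sub_nonneg] using hy
  rw [← sub_eq_zero, ← fderiv_sub hψ hφ, hmin.fderiv_eq_zero]

theorem eventually_add_half_le {L : StrongDual ℝ E} (hf : HasStrictFDerivAt φ L x) {v : E}
    (hv : L v = 1) :
    ∀ᶠ w : E × ℝ in 𝓝 (x, 0), 0 ≤ w.2 → φ w.1 + w.2 / 2 ≤ φ (w.1 + w.2 • v) := by
  set ε : ℝ := 1 / (2 * (‖v‖ + 1)) with hε
  have hεv : ε * ‖v‖ ≤ 1 / 2 := by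
    rw [hε, div_mul_eq_mul_div, div_le_div_iff₀ (by positivity) two_pos]
    linarith
  have hend : Tendsto (fun w : E × ℝ => (w.1 + w.2 • v, w.1)) (𝓝 (x, 0)) (𝓝 (x, x)) := by
    have hc : Continuous fun w : E × ℝ => (w.1 + w.2 • v, w.1) := by fun_prop
    simpa using hc.tendsto (x, 0)
  filter_upwards [hend.eventually (hf.isLittleO.def (c := ε) (by positivity))] with w hw hw0
  simp only [add_sub_cancel_left, map_smul, hv, smul_eq_mul, mul_one, norm_smul,
    Real.norm_of_nonneg hw0] at hw
  have hsmall : ε * (w.2 * ‖v‖) ≤ w.2 / 2 := by nlinarith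
  linarith [(abs_le.1 hw).1]

/-- Transversally to `φ = 0` both functions increase at the same rate, so a zero of `ψ` lies on the
same transversal as a zero of `φ` only if the two zeros coincide. -/
theorem eventually_eq_zero_of_le {L : StrongDual ℝ E} (hφ : HasStrictFDerivAt φ L x)
    (hψ : HasStrictFDerivAt ψ L x) (hL : L ≠ 0) (hφx : φ x = 0)
    (hφc : ∀ᶠ y in 𝓝 x, ContinuousAt φ y) (hle : ∀ᶠ y in 𝓝 x, φ y ≤ ψ y)
    (h0 : ∀ᶠ y in 𝓝 x, φ y = 0 → ψ y = 0) : ∀ᶠ y in 𝓝 x, ψ y = 0 → φ y = 0 := by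
  obtain ⟨v, hv : L v = 1⟩ :=
    LinearMap.surjective (f := L.toLinearMap) (fun h => hL (ContinuousLinearMap.coe_injective h)) 1
  have hbase : ∀ᶠ w : E × ℝ in 𝓝 (x, 0), 0 ≤ w.2 →
      φ w.1 + w.2 / 2 ≤ φ (w.1 + w.2 • v) ∧ ψ w.1 + w.2 / 2 ≤ ψ (w.1 + w.2 • v) := by
    filter_upwards [eventually_add_half_le hφ hv, eventually_add_half_le hψ hv] with w h₁ h₂ hw
    exact ⟨h₁ hw, h₂ hw⟩
  have hend : Tendsto (fun w : E × ℝ => w.1 + w.2 • v) (𝓝 (x, 0)) (𝓝 x) := by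
    have hc : Continuous fun w : E × ℝ => w.1 + w.2 • v := by fun_prop
    simpa using hc.tendsto (x, 0)
  obtain ⟨s, hs, I, hI, hsI⟩ := mem_nhds_prod_iff.1
    (hbase.and (hend.eventually (hφc.and h0)))
  obtain ⟨T, hT0 : 0 < T, hTI⟩ :=
    mem_nhdsGE_iff_exists_Icc_subset.1 (mem_nhdsWithin_of_mem_nhds hI)
  filter_upwards [hs, hle, hφ.continuousAt.eventually
    (lt_mem_nhds (show -(T / 2) < φ x by linarith))] with q hqs hqle hqT hψq
  have hray : ∀ t ∈ Icc 0 T, _ := fun t ht => hsI (mk_mem_prod hqs (hTI ht))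
  have hcont : ContinuousOn (fun t : ℝ => φ (q + t • v)) (Icc 0 T) := fun t ht =>
    ((hray t ht).2.1.comp (f := fun t : ℝ => q + t • v) (by fun_prop)).continuousWithinAt
  obtain ⟨t, ht, htφ : φ (q + t • v) = 0⟩ := intermediate_value_Icc hT0.le hcont
    (show (0 : ℝ) ∈ Icc (φ (q + (0 : ℝ) • v)) _ from
      ⟨by simpa [hψq] using hqle, by linarith [((hray T ⟨hT0.le, le_rfl⟩).1 hT0.le).1]⟩)
  have hψt : ψ q + t / 2 ≤ 0 := (hray t ht).2.2 htφ ▸ ((hray t ht).1 ht.1).2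
  have ht0 : t = 0 := le_antisymm (by linarith) ht.1
  simpa only [ht0, zero_smul, add_zero] using htφ

end FirstOrderContact

section Normal

variable {E : Type*} [NormedAddCommGroup E] [InnerProductSpace ℝ E]

theorem norm_mul_norm_le_of_forall_ker_inner_eq_zero {L : StrongDual ℝ E} {w : E}
    (hw : ∀ v, L v = 0 → inner ℝ v w = 0) : ‖L‖ * ‖w‖ ≤ |L w| := by
  rcases eq_or_ne w 0 with rfl | hw0
  · simp
  have hpos : 0 < ‖w‖ := norm_pos_iff.2 hw0
  rw [← le_div_iff₀ hpos]
  refine L.opNorm_le_bound (by positivity) fun v => ?_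
  have hproj : L w * inner ℝ v w = L v * ‖w‖ ^ 2 := by
    have h := hw (L w • v - L v • w) (by simp [mul_comm])
    rwa [inner_sub_left, real_inner_smul_left, real_inner_smul_left, real_inner_self_eq_norm_sq,
      sub_eq_zero] at h
  have hle : |L v| * ‖w‖ ^ 2 ≤ |L w| * (‖v‖ * ‖w‖) := by
    rw [← abs_of_nonneg (sq_nonneg ‖w‖), ← abs_mul, ← hproj, abs_mul]
    gcongr
    exact abs_real_inner_le_norm v w
  rw [Real.norm_eq_abs, div_mul_eq_mul_div, le_div_iff₀ hpos]
  nlinarith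

theorem eventually_eq_of_normal {f : E → ℝ} {x : E} (hf : ContDiffAt ℝ 1 f x)
    (hd : fderiv ℝ f x ≠ 0) :
    ∀ᶠ w in 𝓝 (x, x), f w.1 = f w.2 →
      (∀ v, fderiv ℝ f w.1 v = 0 → inner ℝ v (w.2 - w.1) = 0) → w.2 = w.1 := by
  have hε : 0 < ‖fderiv ℝ f x‖ / 4 := by positivity
  have hcont : ContinuousAt (fun w : E × E => fderiv ℝ f w.1) (x, x) :=
    (hf.fderiv_right (m := 0) (by norm_num)).continuousAt.comp (f := Prod.fst) continuousAt_fst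
  filter_upwards [(hf.hasStrictFDerivAt one_ne_zero).isLittleO.def hε,
    hcont (Metric.ball_mem_nhds _ hε)] with w hstrict hnear heq hν
  have hnear' : ‖fderiv ℝ f w.1 - fderiv ℝ f x‖ ≤ ‖fderiv ℝ f x‖ / 4 :=
    (mem_ball_iff_norm.1 hnear).le
  have hlower := norm_mul_norm_le_of_forall_ker_inner_eq_zero hν
  have hnorm : ‖fderiv ℝ f x‖ * (3 / 4) ≤ ‖fderiv ℝ f w.1‖ := by
    have := norm_sub_norm_le (fderiv ℝ f x) (fderiv ℝ f w.1)
    rw [norm_sub_rev] at this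
    linarith
  have hupper : |fderiv ℝ f w.1 (w.2 - w.1)| ≤ ‖fderiv ℝ f x‖ / 2 * ‖w.2 - w.1‖ := by
    rw [heq, sub_self, zero_sub, ← map_neg, neg_sub, norm_sub_rev w.1 w.2] at hstrict
    have h := (fderiv ℝ f w.1 - fderiv ℝ f x).le_of_opNorm_le hnear' (w.2 - w.1)
    rw [sub_apply] at h
    have := norm_le_norm_sub_add (fderiv ℝ f w.1 (w.2 - w.1)) (fderiv ℝ f x (w.2 - w.1))
    rw [← Real.norm_eq_abs]
    linarith
  by_contra hne
  have hpos : 0 < ‖w.2 - w.1‖ := norm_pos_iff.2 (sub_ne_zero.2 hne)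
  nlinarith [mul_pos hε hpos]

end Normal

section Horizontal

variable {E : Type*} [NormedAddCommGroup E] [InnerProductSpace ℝ E] [FiniteDimensional ℝ E]
  {G : E → StrongDual ℝ E →L[ℝ] E} {ρ φ ψ : E → ℝ} {b : E × ℝ × StrongDual ℝ E → ℝ} {x₀ : E} {p : ℝ}

theorem eventually_inner_eq_zero_of_normal (hp : 0 ≤ p) (hG : ContDiffAt ℝ 2 G x₀)
    (hρ : ContDiffAt ℝ 2 ρ x₀) (hρx : ρ x₀ ≠ 0) (hnn : ∀ᶠ y in 𝓝 x₀, IsNonnegForm (G y))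
    (hφ : ContDiffAt ℝ 2 φ x₀) (hψ : ContDiffAt ℝ 2 ψ x₀) (hφψ : ψ x₀ = φ x₀)
    (hle : ∀ᶠ y in 𝓝 x₀, φ y ≤ ψ y) (hb : ContDiffAt ℝ 1 b (x₀, φ x₀, fderiv ℝ φ x₀))
    (hq : 0 < fderiv ℝ φ x₀ (G x₀ (fderiv ℝ φ x₀)))
    (hH : ∀ᶠ y in 𝓝 x₀,
      (ρ y)⁻¹ * divergence (fun y => ρ y • flux p (G y) (fderiv ℝ ψ y)) y +
          b (y, ψ y, fderiv ℝ ψ y) ≤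
        (ρ y)⁻¹ * divergence (fun y => ρ y • flux p (G y) (fderiv ℝ φ y)) y +
          b (y, φ y, fderiv ℝ φ y)) :
    ∀ᶠ x in 𝓝 x₀, ψ x = φ x → ∀ z, IsLocalMinOn (dist · z) {y | ψ y = φ y} x →
      ∀ η, 0 < p ∨ fderiv ℝ φ x (G x η) = 0 → inner ℝ (G x η) (z - x) = 0 := by
  have hd := fderiv_eq_of_le_of_eq (hφ.differentiableAt two_ne_zero)
    (hψ.differentiableAt two_ne_zero) hle hφψ
  obtain ⟨K, hK⟩ := exists_traceL_fluxSymbol_le hG hρ hρx hnn hφ hψ hφψ hd hb hq hH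
  have hdφ : ContinuousAt (fderiv ℝ φ) x₀ := (hφ.fderiv_right (m := 1) (by norm_num)).continuousAt
  have hpos : ∀ᶠ y in 𝓝 x₀, 0 < fderiv ℝ φ y (G y (fderiv ℝ φ y)) :=
    (hdφ.clm_apply (hG.continuousAt.clm_apply hdφ)).eventually (lt_mem_nhds hq)
  have hall := (((hK.and hpos).and (hnn.and hle)).and
    ((hG.eventually (by simp)).and ((hφ.eventually (by simp)).and (hψ.eventually (by simp)))))
  filter_upwards [hall.eventually_nhds] with x hx hux z hz η hη
  obtain ⟨⟨⟨-, hpx⟩, hnnx, -⟩, hGx, hφx, -⟩ := hx.self_of_nhds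
  have hmin : ∀ᶠ y in 𝓝 x, ψ y = φ y → dist x z ≤ dist y z := eventually_nhdsWithin_iff.1 hz
  rw [real_inner_comm]
  refine apply_eq_zero_of_apply_fluxSymbol_nonpos (θ := innerSL ℝ (z - x)) hnnx hp hpx ?_ hη
  refine apply_nonpos_of_normal (u := ψ - φ) (K := K)
    (S := fun y => fluxSymbol p (G y) (fderiv ℝ φ y)) (hx.and hmin)
    (fun y hy => hy.1.2.2.2.sub hy.1.2.2.1) (fun y hy => sub_nonneg.2 hy.1.1.2.2)
    (fun y hy => isNonnegForm_fluxSymbol hy.1.1.2.1 hp hy.1.1.1.2) ?_ (fun y hy => ?_)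
    (sub_eq_zero.2 hux) (fun y hy h => hy.2 (sub_eq_zero.1 h))
  · exact continuousAt_fluxSymbol (hGx.of_le one_le_two)
      (hφx.fderiv_right (m := 1) (by norm_num)) (hx.mono fun y hy => hy.1.2.1) hpx
  · have hd2 := fderiv_fderiv_sub_const_smul hy.1.2.2.2 hy.1.2.2.1 1
    rw [one_smul, one_smul] at hd2
    simpa only [hd2, fderiv_sub (hy.1.2.2.2.differentiableAt two_ne_zero)
      (hy.1.2.2.1.differentiableAt two_ne_zero), Pi.sub_apply] using hy.1.1.1.1

end Horizontal

end ContactSet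

/-! ### Propagation of contact -/

section Propagation

theorem eventually_exists_nearest {E : Type*} [PseudoMetricSpace E] [ProperSpace E] {F O : Set E}
    {x₀ : E} (hF : IsClosed F) (hx₀ : x₀ ∈ F) (hO : O ∈ 𝓝 x₀) :
    ∀ᶠ q in 𝓝 x₀, ∃ x ∈ F ∩ O, ∀ y ∈ F, dist x q ≤ dist y q := by
  obtain ⟨R, hR, hball⟩ := Metric.mem_nhds_iff.1 hO
  filter_upwards [Metric.ball_mem_nhds x₀ (half_pos hR)] with q hq
  obtain ⟨x, hxF, hxd⟩ := hF.exists_infDist_eq_dist ⟨x₀, hx₀⟩ q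
  have hmin : ∀ y ∈ F, dist x q ≤ dist y q := fun y hy => by
    rw [dist_comm x, dist_comm y, ← hxd]
    exact Metric.infDist_le_dist_of_mem hy
  refine ⟨x, ⟨hxF, hball ?_⟩, hmin⟩
  calc dist x x₀ ≤ dist x q + dist q x₀ := dist_triangle ..
    _ ≤ dist q x₀ + dist q x₀ := by gcongr; exact dist_comm x₀ q ▸ hmin x₀ hx₀
    _ < R := by linarith [Metric.mem_ball.1 hq]

section Correction

variable {E : Type*} [NormedAddCommGroup E] [InnerProductSpace ℝ E] [ProperSpace E] {F O : Set E}

/-- A covector `η` with `df(Aη) = 0` at a single point is extended to the field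
`η - (df(Aη) / df(A df)) df`, which has this property everywhere. -/
theorem TangentTo.inter_levelSet_of_eq_apply {A : E → StrongDual ℝ E →L[ℝ] E} {f : E → ℝ}
    {V : E → E} (hF : IsClosed F) (hO : IsOpen O) (hA : ContDiffOn ℝ 1 A O)
    (hf : ContDiffOn ℝ 2 f O) (hfA : ∀ y ∈ O, fderiv ℝ f y (A y (fderiv ℝ f y)) ≠ 0)
    (htan : ∀ x ∈ F ∩ O, ∀ z, IsLocalMinOn (dist · z) F x → ∀ η, fderiv ℝ f x (A x η) = 0 →
      inner ℝ (A x η) (z - x) = 0)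
    (hV : ∀ y ∈ O, f y = 0 → ∃ η, A y η = V y ∧ fderiv ℝ f y (V y) = 0) :
    TangentTo (F ∩ f ⁻¹' {0}) O V := by
  intro x hx z hz
  obtain ⟨η, hη, hker⟩ := hV x hx.2 hx.1.2
  rw [← hη] at hker ⊢
  set c : E → ℝ := fun y =>
    fderiv ℝ f y (A y η) / fderiv ℝ f y (A y (fderiv ℝ f y)) with hc
  have hdf : ContDiffOn ℝ 1 (fderiv ℝ f) O := hf.fderiv_of_isOpen hO (by norm_num)
  have hsmooth : ContDiffOn ℝ 1 (fun y => A y (η - c y • fderiv ℝ f y)) O := by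
    refine hA.clm_apply (contDiffOn_const.sub (ContDiffOn.smul (ContDiffOn.div ?_ ?_ hfA) hdf))
    · exact hdf.clm_apply (hA.clm_apply contDiffOn_const)
    · exact hdf.clm_apply (hA.clm_apply hdf)
  have hlevel : ∀ y ∈ O, fderiv ℝ f y (A y (η - c y • fderiv ℝ f y)) = 0 := fun y hy => by
    rw [map_sub, map_sub, map_smul, map_smul, smul_eq_mul, hc, div_mul_cancel₀ _ (hfA y hy),
      sub_self]
  have htangent : TangentTo F O fun y => A y (η - c y • fderiv ℝ f y) := fun y hy z hz =>
    htan y hy z hz _ (hlevel y hy.2)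
  have horth := htangent.inter_levelSet hF hO hsmooth
    (hf.differentiableOn two_ne_zero) (fun y hy => hlevel y hy.2) x hx z hz
  simpa only [hc, hker, zero_div, zero_smul, sub_zero] using horth

end Correction

section LieRank

variable {m : ℕ} {M : Type*} [TopologicalSpace M] [ChartedSpace (Coords m) M]
  [IsManifold (𝓡 (m + 1)) ∞ M] {x₀ : M} {F O : Set (Coords m)} {y₀ : Coords m}
  {U : Set M} {r : ℕ} {X : Fin r → Π x : M, TangentSpace (𝓡 (m + 1)) x}

theorem eventually_exists_lieSpanInChart_orthogonal (hF : IsClosed F) (hO : IsOpen O)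
    (hy₀ : y₀ ∈ F ∩ O) (hU : IsOpen U) (hX : ∀ i, SmoothFieldOn U (X i))
    (hOU : ∀ y ∈ O, y ∈ (chart m x₀).target ∧ (chart m x₀).symm y ∈ U)
    (htan : ∀ i, TangentTo F O (fieldInChart x₀ (X i))) :
    ∀ᶠ q in 𝓝 y₀, ∃ x ∈ F ∩ O, ∀ v ∈ lieSpanInChart x₀ U X x, inner ℝ v (q - x) = 0 := by
  filter_upwards [eventually_exists_nearest hF hy₀.1 (hO.mem_nhds hy₀.2)] with q hq
  obtain ⟨x, hx, hmin⟩ := hq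
  refine ⟨x, hx, fun v hv => ?_⟩
  suffices h : lieSpanInChart x₀ U X x ≤ (ℝ ∙ (q - x))ᗮ from
    Submodule.mem_orthogonal_singleton_iff_inner_left.1 (h hv)
  refine Submodule.span_le.2 ?_
  rintro _ ⟨Z, hZ, rfl⟩
  exact Submodule.mem_orthogonal_singleton_iff_inner_left.2
    ((isLieClosed_tangentTo hF hO).of_lieSpan hU hX hOU htan hZ x hx q
      (eventually_nhdsWithin_of_forall hmin))

theorem eventually_mem_of_lieRank_eq (hF : IsClosed F) (hO : IsOpen O)
    (hy₀ : y₀ ∈ F ∩ O) (hU : IsOpen U) (hX : ∀ i, SmoothFieldOn U (X i))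
    (hOU : ∀ y ∈ O, y ∈ (chart m x₀).target ∧ (chart m x₀).symm y ∈ U)
    (htan : ∀ i, TangentTo F O (fieldInChart x₀ (X i)))
    (hrank : ∀ y ∈ F ∩ O, lieRank U X ((chart m x₀).symm y) = m + 1) :
    ∀ᶠ y in 𝓝 y₀, y ∈ F := by
  filter_upwards [eventually_exists_lieSpanInChart_orthogonal hF hO hy₀ hU hX hOU htan]
    with q hq
  obtain ⟨x, hx, horth⟩ := hq
  have htop : lieSpanInChart x₀ U X x = ⊤ := by
    apply Submodule.eq_top_of_finrank_eq
    rw [finrank_lieSpanInChart (hOU x hx.2).1, hrank x hx, finrank_euclideanSpace_fin]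
  have hqx : q - x = 0 := inner_self_eq_zero.1 (horth (q - x) (htop ▸ Submodule.mem_top))
  exact sub_eq_zero.1 hqx ▸ hx.1

theorem eventually_mem_of_lieRank_eq_on_levelSet {f : Coords m → ℝ} (hF : IsClosed F)
    (hO : IsOpen O) (hy₀ : y₀ ∈ F ∩ O) (hf : ContDiffOn ℝ 2 f O)
    (hdf : ∀ y ∈ O, fderiv ℝ f y ≠ 0) (hfF : ∀ y ∈ F, f y = 0)
    (hU : IsOpen U) (hX : ∀ i, SmoothFieldOn U (X i))
    (hOU : ∀ y ∈ O, y ∈ (chart m x₀).target ∧ (chart m x₀).symm y ∈ U)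
    (htan : ∀ i, TangentTo F O (fieldInChart x₀ (X i)))
    (hlevel : ∀ i, ∀ y ∈ O, f y = 0 → fderiv ℝ f y (fieldInChart x₀ (X i) y) = 0)
    (hrank : ∀ y ∈ F ∩ O, lieRank U X ((chart m x₀).symm y) = m) :
    ∀ᶠ y in 𝓝 y₀, f y = 0 → y ∈ F := by
  have hker : ∀ x ∈ F ∩ O, lieSpanInChart x₀ U X x = LinearMap.ker (fderiv ℝ f x).toLinearMap := by
    intro x hx
    refine Submodule.eq_of_le_of_finrank_eq (Submodule.span_le.2 ?_) ?_
    · rintro _ ⟨Z, hZ, rfl⟩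
      exact (isLieClosed_fderiv_apply_eq_zero hO hf hdf).of_lieSpan hU hX hOU hlevel hZ x hx.2
        (hfF x hx.1)
    · have hdim := Module.Dual.finrank_ker_add_one_of_ne_zero
        (ContinuousLinearMap.coe_injective.ne (hdf x hx.2))
      rw [finrank_euclideanSpace_fin, Nat.add_right_cancel_iff] at hdim
      rw [finrank_lieSpanInChart (hOU x hx.2).1, hrank x hx, hdim]
  obtain ⟨s, t, hs, hy₀s, ht, hy₀t, hst⟩ := mem_nhds_prod_iff'.1 (eventually_eq_of_normal
    ((hf.contDiffAt (hO.mem_nhds hy₀.2)).of_le one_le_two) (hdf y₀ hy₀.2))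
  filter_upwards [ht.mem_nhds hy₀t, eventually_exists_lieSpanInChart_orthogonal hF (hO.inter hs)
    ⟨hy₀.1, hy₀.2, hy₀s⟩ hU hX (fun y hy => hOU y hy.1) fun i => (htan i).mono inter_subset_left]
    with q hqt hq hfq
  obtain ⟨x, ⟨hxF, hxO, hxs⟩, horth⟩ := hq
  have hqx : q = x := hst (mk_mem_prod hxs hqt) ((hfF x hxF).trans hfq.symm) fun v hv =>
    horth v ((hker x ⟨hxF, hxO⟩).ge hv)
  exact hqx ▸ hxF

end LieRank

end Propagation

/-! ### Propagation on the manifold -/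

section Application

variable {m : ℕ} {M : Type*} [TopologicalSpace M] [ChartedSpace (Coords m) M] {x₀ : M}

theorem eventually_nhds_iff_chart_symm {P : M → Prop} :
    (∀ᶠ x in 𝓝 x₀, P x) ↔ ∀ᶠ y in 𝓝 (chart m x₀ x₀), P ((chart m x₀).symm y) := by
  refine ⟨fun h => ?_, fun h => ?_⟩
  · exact (continuousAt_extChartAt_symm x₀).eventually (by rwa [extChartAt_to_inv])
  · filter_upwards [(continuousAt_extChartAt x₀).eventually h,
      extChartAt_source_mem_nhds (I := 𝓡 (m + 1)) x₀] with x hx hxs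
    rwa [(chart m x₀).left_inv hxs] at hx

theorem eventually_mem_chart_target :
    ∀ᶠ y in 𝓝 (chart m x₀ x₀), y ∈ (chart m x₀).target :=
  extChartAt_target_mem_nhds x₀

theorem isLocalMinOn_of_inter {X : Type*} [TopologicalSpace X] {f : X → ℝ} {C F : Set X} {x : X}
    (hC : C ∈ 𝓝 x) (h : IsLocalMinOn f (C ∩ F) x) : IsLocalMinOn f F x := by
  rwa [IsLocalMinOn, inter_comm, nhdsWithin_inter_of_mem' (nhdsWithin_le_nhds hC)] at h

theorem eventually_continuousAt_comp_chart_symm {f : M → ℝ}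
    (hf : ∀ᶠ x in 𝓝 x₀, ContinuousAt f x) :
    ∀ᶠ y in 𝓝 (chart m x₀ x₀), ContinuousAt (f ∘ (chart m x₀).symm) y := by
  filter_upwards [eventually_mem_chart_target, eventually_nhds_iff_chart_symm.1 hf] with y hy hfy
  exact hfy.comp (continuousAt_extChartAt_symm'' hy)

variable [IsManifold (𝓡 (m + 1)) ∞ M] {g : CoMetric m M}

theorem exists_raiseInChart_eq {y : Coords m} (hy : y ∈ (chart m x₀).target)
    {v : TangentSpace (𝓡 (m + 1)) ((chart m x₀).symm y)}
    (hv : v ∈ g.horizontal ((chart m x₀).symm y)) :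
    ∃ η, raiseInChart g x₀ y η = chartDeriv x₀ y v := by
  obtain ⟨θ, rfl⟩ := hv
  refine ⟨θ.comp (chartSymmDeriv x₀ y), ?_⟩
  rw [raiseInChart_apply]
  congr 2
  ext w
  exact congrArg θ (chartSymmDeriv_chartDeriv hy w)

theorem eventually_contDiffAt_comp_chart_symm {f : M → ℝ}
    (hf : ∀ᶠ x in 𝓝 x₀, ContMDiffAt (𝓡 (m + 1)) 𝓘(ℝ, ℝ) ∞ f x) :
    ∀ᶠ y in 𝓝 (chart m x₀ x₀), ContDiffAt ℝ ∞ (f ∘ (chart m x₀).symm) y := by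
  filter_upwards [eventually_mem_chart_target, eventually_nhds_iff_chart_symm.1 hf] with y hy hfy
  exact contDiffAt_comp_chart_symm hy hfy

theorem norm_differential_ne_zero_iff {f : M → ℝ}
    (hf : MDifferentiableAt (𝓡 (m + 1)) 𝓘(ℝ, ℝ) f x₀) :
    g.norm (differential f x₀) ≠ 0 ↔
      0 < fderiv ℝ (f ∘ (chart m x₀).symm) (chart m x₀ x₀)
        (raiseInChart g x₀ (chart m x₀ x₀)
          (fderiv ℝ (f ∘ (chart m x₀).symm) (chart m x₀ x₀))) := by
  have hnorm := norm_differential g (φ := f) (mem_extChartAt_target x₀)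
    (by rwa [extChartAt_to_inv])
  rw [extChartAt_to_inv] at hnorm
  rw [hnorm, Real.sqrt_ne_zero']

theorem eventually_norm_differential_ne_zero {f : M → ℝ}
    (hf : ∀ᶠ x in 𝓝 x₀, ContMDiffAt (𝓡 (m + 1)) 𝓘(ℝ, ℝ) ∞ f x)
    (hf0 : g.norm (differential f x₀) ≠ 0) :
    ∀ᶠ y in 𝓝 (chart m x₀ x₀), g.norm (differential f ((chart m x₀).symm y)) ≠ 0 ∧
      0 < fderiv ℝ (f ∘ (chart m x₀).symm) y
        (raiseInChart g x₀ y (fderiv ℝ (f ∘ (chart m x₀).symm) y)) := by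
  have hdf : ContinuousAt (fderiv ℝ (f ∘ (chart m x₀).symm)) (chart m x₀ x₀) :=
    ((eventually_contDiffAt_comp_chart_symm hf).self_of_nhds.fderiv_right (m := ∞)
      (by simp)).continuousAt
  have hG := (contDiffAt_raiseInChart g (mem_extChartAt_target x₀)).continuousAt
  filter_upwards [eventually_mem_chart_target, eventually_nhds_iff_chart_symm.1 hf,
    (hdf.clm_apply (hG.clm_apply hdf)).eventually_const_lt ((norm_differential_ne_zero_iff
      (hf.self_of_nhds.mdifferentiableAt (by simp))).1 hf0)] with y hy hfy hpos
  rw [norm_differential g hy (hfy.mdifferentiableAt (by simp))]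
  exact ⟨(Real.sqrt_pos.2 hpos).ne', hpos⟩

theorem eventually_eq_of_hasLieRankNear {φ ψ : M → ℝ}
    (hφ : ∀ᶠ x in 𝓝 x₀, ContinuousAt φ x) (hψ : ∀ᶠ x in 𝓝 x₀, ContinuousAt ψ x)
    (hx₀ : ψ x₀ = φ x₀) (hrank : HasLieRankNear x₀ Set.univ g.horizontal (m + 1))
    (hnormal : ∀ᶠ x in 𝓝 (chart m x₀ x₀),
      (ψ ∘ (chart m x₀).symm) x = (φ ∘ (chart m x₀).symm) x → ∀ z, IsLocalMinOn (dist · z)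
          {y | (ψ ∘ (chart m x₀).symm) y = (φ ∘ (chart m x₀).symm) y} x →
        ∀ η, inner ℝ (raiseInChart g x₀ x η) (z - x) = 0) :
    ∀ᶠ x in 𝓝 x₀, ψ x = φ x := by
  obtain ⟨U, r, X, hU, hx₀U, hX, hbasis, hrk⟩ := hrank
  obtain ⟨C, hCx, hC, hCP⟩ := exists_mem_nhds_isClosed_subset
    (eventually_mem_chart_target.and ((eventually_nhds_iff_chart_symm.1
      (hU.eventually_mem hx₀U)).and ((eventually_continuousAt_comp_chart_symm hφ).and
        ((eventually_continuousAt_comp_chart_symm hψ).and hnormal))))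
  choose htarget hCU hφC hψC hnormalC using hCP
  have hOC : interior C ⊆ C := interior_subset
  have hF : IsClosed {y ∈ C | (ψ ∘ (chart m x₀).symm) y = (φ ∘ (chart m x₀).symm) y} :=
    hC.isClosed_eq (fun y hy => (hψC hy).continuousWithinAt)
      fun y hy => (hφC hy).continuousWithinAt
  have hy₀ : (ψ ∘ (chart m x₀).symm) (chart m x₀ x₀) = (φ ∘ (chart m x₀).symm) (chart m x₀ x₀) := by
    simp only [Function.comp_apply, extChartAt_to_inv, hx₀]
  refine eventually_nhds_iff_chart_symm.2 <| (eventually_mem_of_lieRank_eq hF isOpen_interior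
    ⟨⟨mem_of_mem_nhds hCx, hy₀⟩, mem_interior_iff_mem_nhds.2 hCx⟩ hU hX
    (fun y hy => ⟨htarget (hOC hy), hCU (hOC hy)⟩) (fun i x hx z hz => ?_)
    fun y hy => hrk _ ⟨hCU hy.1.1, mem_univ _⟩).mono fun y hy => hy.2
  have hmem : X i ((chart m x₀).symm x) ∈ g.horizontal _ :=
    (hbasis _ ⟨hCU hx.1.1, mem_univ _⟩).2.le (Submodule.subset_span ⟨i, rfl⟩)
  obtain ⟨η, hη⟩ := exists_raiseInChart_eq (htarget hx.1.1) hmem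
  rw [fieldInChart_apply (htarget hx.1.1), ← hη]
  exact hnormalC hx.1.1 hx.1.2 z
    (isLocalMinOn_of_inter (mem_interior_iff_mem_nhds.1 hx.2) hz) η

theorem fieldInChart_mem_of_horizontal_inf_ker {φ : M → ℝ} {y : Coords m}
    {Z : Π x : M, TangentSpace (𝓡 (m + 1)) x} (hy : y ∈ (chart m x₀).target)
    (hφ : MDifferentiableAt (𝓡 (m + 1)) 𝓘(ℝ, ℝ) φ ((chart m x₀).symm y))
    (hZ : Z ((chart m x₀).symm y) ∈ g.horizontal _ ⊓
      LinearMap.ker (differential φ ((chart m x₀).symm y)).toLinearMap) :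
    ∃ η, raiseInChart g x₀ y η = fieldInChart x₀ Z y ∧
      fderiv ℝ (φ ∘ (chart m x₀).symm) y (fieldInChart x₀ Z y) = 0 := by
  obtain ⟨hhor, hker⟩ := hZ
  obtain ⟨η, hη⟩ := exists_raiseInChart_eq hy hhor
  rw [differential_eq_comp hy hφ] at hker
  rw [fieldInChart_apply hy]
  exact ⟨η, hη, hker⟩

theorem eventually_eq_zero_of_hasLieRankNear_levelSet {φ ψ : M → ℝ}
    (hφ : ∀ᶠ x in 𝓝 x₀, ContMDiffAt (𝓡 (m + 1)) 𝓘(ℝ, ℝ) ∞ φ x)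
    (hφ0 : g.norm (differential φ x₀) ≠ 0) (hψ : ∀ᶠ x in 𝓝 x₀, ContinuousAt ψ x)
    (hφx : φ x₀ = 0) (hψx : ψ x₀ = 0)
    (hrank : HasLieRankNear x₀ {x | φ x = 0}
      (fun x => g.horizontal x ⊓ LinearMap.ker (differential φ x).toLinearMap) m)
    (hnormal : ∀ᶠ x in 𝓝 (chart m x₀ x₀),
      (ψ ∘ (chart m x₀).symm) x = (φ ∘ (chart m x₀).symm) x → ∀ z, IsLocalMinOn (dist · z)
          {y | (ψ ∘ (chart m x₀).symm) y = (φ ∘ (chart m x₀).symm) y} x →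
        ∀ η, fderiv ℝ (φ ∘ (chart m x₀).symm) x (raiseInChart g x₀ x η) = 0 →
          inner ℝ (raiseInChart g x₀ x η) (z - x) = 0) :
    ∀ᶠ x in 𝓝 x₀, φ x = 0 → ψ x = 0 := by
  obtain ⟨U, r, X, hU, hx₀U, hX, hbasis, hrk⟩ := hrank
  obtain ⟨C, hCx, hC, hCP⟩ := exists_mem_nhds_isClosed_subset
    (eventually_mem_chart_target.and ((eventually_nhds_iff_chart_symm.1
      (hU.eventually_mem hx₀U)).and ((eventually_continuousAt_comp_chart_symm hψ).and (hnormal.and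
        ((eventually_nhds_iff_chart_symm.1 hφ).and
          (eventually_norm_differential_ne_zero hφ hφ0))))))
  choose htarget hCU hψC hnormalC hφC _ hpos using hCP
  have hOC : interior C ⊆ C := interior_subset
  have hφ' : ∀ y ∈ C, ContDiffAt ℝ ∞ (φ ∘ (chart m x₀).symm) y := fun y hy =>
    contDiffAt_comp_chart_symm (htarget hy) (hφC hy)
  have hφO : ContDiffOn ℝ 2 (φ ∘ (chart m x₀).symm) (interior C) := fun y hy =>
    ((hφ' y (hOC hy)).of_le two_le_smooth).contDiffWithinAt
  set F := {y ∈ C | (ψ ∘ (chart m x₀).symm) y = (φ ∘ (chart m x₀).symm) y}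
  have hF : IsClosed F := hC.isClosed_eq (fun y hy => (hψC hy).continuousWithinAt)
    fun y hy => (hφ' y hy).continuousAt.continuousWithinAt
  have hF₀ : IsClosed (F ∩ (φ ∘ (chart m x₀).symm) ⁻¹' {0}) :=
    ContinuousOn.preimage_isClosed_of_isClosed
      (fun y hy => (hφ' y hy.1).continuousAt.continuousWithinAt) hF isClosed_singleton
  have hgen : ∀ i, ∀ y ∈ interior C, φ ((chart m x₀).symm y) = 0 →
      ∃ η, raiseInChart g x₀ y η = fieldInChart x₀ (X i) y ∧
        fderiv ℝ (φ ∘ (chart m x₀).symm) y (fieldInChart x₀ (X i) y) = 0 := fun i y hy hy0 =>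
    fieldInChart_mem_of_horizontal_inf_ker (htarget (hOC hy))
      ((hφC (hOC hy)).mdifferentiableAt (by simp))
      ((hbasis _ ⟨hCU (hOC hy), hy0⟩).2.le (Submodule.subset_span ⟨i, rfl⟩))
  have htan : ∀ i, TangentTo (F ∩ (φ ∘ (chart m x₀).symm) ⁻¹' {0}) (interior C)
      (fieldInChart x₀ (X i)) := fun i =>
    .inter_levelSet_of_eq_apply hF isOpen_interior (A := raiseInChart g x₀)
      (fun y hy => ((contDiffAt_raiseInChart g (htarget (hOC hy))).of_le
        (by simp)).contDiffWithinAt) hφO (fun y hy => (hpos (hOC hy)).ne')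
      (fun x hx z hz => hnormalC hx.1.1 hx.1.2 z
        (isLocalMinOn_of_inter (mem_interior_iff_mem_nhds.1 hx.2) hz)) (hgen i)
  have hφy : φ ((chart m x₀).symm (chart m x₀ x₀)) = 0 := by rwa [extChartAt_to_inv]
  have hψy : ψ ((chart m x₀).symm (chart m x₀ x₀)) = 0 := by rwa [extChartAt_to_inv]
  exact eventually_nhds_iff_chart_symm.2 <| (eventually_mem_of_lieRank_eq_on_levelSet hF₀
    isOpen_interior
    ⟨⟨⟨mem_of_mem_nhds hCx, hψy.trans hφy.symm⟩, hφy⟩, mem_interior_iff_mem_nhds.2 hCx⟩ hφO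
    (fun y hy h => (hpos (hOC hy)).ne' (by rw [h]; rfl)) (fun y hy => hy.2) hU hX
    (fun y hy => ⟨htarget (hOC hy), hCU (hOC hy)⟩) htan
    (fun i y hy hy0 => (hgen i y hy hy0).choose_spec.2)
    fun y hy => hrk _ ⟨hCU hy.1.1.1, hy.1.2⟩).mono fun y hy hy0 => (hy hy0).1.2.trans hy0

end Application

section ContactNormal

variable {m : ℕ} {M : Type*} [TopologicalSpace M] [ChartedSpace (Coords m) M] {x₀ : M}

/-- The lower order term `b(x, z, q)` in the chart at `x₀`, with `q` given by its components. -/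
noncomputable def lowerOrderInChart (b : Π x : M, ℝ → (TangentSpace (𝓡 (m + 1)) x →L[ℝ] ℝ) → ℝ)
    (x₀ : M) (w : Coords m × ℝ × StrongDual ℝ (Coords m)) : ℝ :=
  b ((chart m x₀).symm w.1) w.2.1 (w.2.2.comp (chartDeriv x₀ w.1))

variable {b : Π x : M, ℝ → (TangentSpace (𝓡 (m + 1)) x →L[ℝ] ℝ) → ℝ}

theorem contDiffAt_lowerOrderInChart {U : Set M} (hb : SmoothLowerOrderOn U b) (hU : U ∈ 𝓝 x₀)
    (z : ℝ) (q : StrongDual ℝ (Coords m)) :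
    ContDiffAt ℝ ∞ (lowerOrderInChart b x₀) (chart m x₀ x₀, z, q) := by
  refine (hb x₀).contDiffAt ?_
  rw [nhds_prod_eq]
  exact prod_mem_prod
    (inter_mem eventually_mem_chart_target (eventually_nhds_iff_chart_symm.1 hU)) univ_mem

theorem differential_eq_fderiv {f : M → ℝ} (hf : MDifferentiableAt (𝓡 (m + 1)) 𝓘(ℝ, ℝ) f x₀) :
    differential f x₀ = fderiv ℝ (f ∘ (chart m x₀).symm) (chart m x₀ x₀) :=
  hf.mfderiv.trans (by rw [ModelWithCorners.range_eq_univ, fderivWithin_univ]; rfl)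

theorem differentiableAt_comp_chart_symm {f : M → ℝ}
    (hf : MDifferentiableAt (𝓡 (m + 1)) 𝓘(ℝ, ℝ) f x₀) :
    DifferentiableAt ℝ (f ∘ (chart m x₀).symm) (chart m x₀ x₀) := by
  have h := hf.differentiableWithinAt_writtenInExtChartAt
  rwa [ModelWithCorners.range_eq_univ, differentiableWithinAt_univ] at h

variable {φ ψ : M → ℝ}

theorem differential_eq_of_le_of_eq (hφ : MDifferentiableAt (𝓡 (m + 1)) 𝓘(ℝ, ℝ) φ x₀)
    (hψ : MDifferentiableAt (𝓡 (m + 1)) 𝓘(ℝ, ℝ) ψ x₀)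
    (hle : ∀ᶠ x in 𝓝 x₀, φ x ≤ ψ x) (hx₀ : ψ x₀ = φ x₀) :
    differential (m := m) ψ x₀ = differential φ x₀ := by
  rw [differential_eq_fderiv hφ, differential_eq_fderiv hψ]
  exact fderiv_eq_of_le_of_eq (differentiableAt_comp_chart_symm hφ)
    (differentiableAt_comp_chart_symm hψ) (eventually_nhds_iff_chart_symm.1 hle)
    (by simp only [Function.comp_apply, extChartAt_to_inv, hx₀])

variable [IsManifold (𝓡 (m + 1)) ∞ M] {g : CoMetric m M}

theorem eventually_eq_zero_imp_of_le
    (hφ : ∀ᶠ x in 𝓝 x₀, ContMDiffAt (𝓡 (m + 1)) 𝓘(ℝ, ℝ) ∞ φ x)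
    (hψ : ∀ᶠ x in 𝓝 x₀, ContMDiffAt (𝓡 (m + 1)) 𝓘(ℝ, ℝ) ∞ ψ x)
    (hφ0 : g.norm (differential φ x₀) ≠ 0) (hφx : φ x₀ = 0) (hψx : ψ x₀ = 0)
    (hle : ∀ᶠ x in 𝓝 x₀, φ x ≤ ψ x) (hsub : ∀ᶠ x in 𝓝 x₀, φ x = 0 → ψ x = 0) :
    ∀ᶠ x in 𝓝 x₀, ψ x = 0 → φ x = 0 := by
  have hφd := hφ.self_of_nhds.mdifferentiableAt (by simp)
  have hψd := hψ.self_of_nhds.mdifferentiableAt (by simp)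
  have hφc := eventually_contDiffAt_comp_chart_symm hφ
  have hd : fderiv ℝ (ψ ∘ (chart m x₀).symm) (chart m x₀ x₀) =
      fderiv ℝ (φ ∘ (chart m x₀).symm) (chart m x₀ x₀) :=
    (differential_eq_fderiv hψd).symm.trans
      ((differential_eq_of_le_of_eq hφd hψd hle (hψx.trans hφx.symm)).trans
        (differential_eq_fderiv hφd))
  have hd0 : fderiv ℝ (φ ∘ (chart m x₀).symm) (chart m x₀ x₀) ≠ 0 := fun h => by
    have hpos := (norm_differential_ne_zero_iff hφd).1 hφ0
    rw [h] at hpos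
    exact lt_irrefl _ hpos
  exact eventually_nhds_iff_chart_symm.2 <| eventually_eq_zero_of_le
    (hφc.self_of_nhds.hasStrictFDerivAt (by simp))
    (hd ▸ (eventually_contDiffAt_comp_chart_symm hψ).self_of_nhds.hasStrictFDerivAt (by simp)) hd0
    (by simp only [extChartAt_to_inv, hφx])
    (hφc.mono fun y hy => hy.continuousAt) (eventually_nhds_iff_chart_symm.1 hle)
    (eventually_nhds_iff_chart_symm.1 hsub)

variable {dv : VolumeForm m M} {p : ℝ}

theorem eventually_curvature_le_in_chart
    (hφ : ∀ᶠ x in 𝓝 x₀, ContMDiffAt (𝓡 (m + 1)) 𝓘(ℝ, ℝ) ∞ φ x)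
    (hψ : ∀ᶠ x in 𝓝 x₀, ContMDiffAt (𝓡 (m + 1)) 𝓘(ℝ, ℝ) ∞ ψ x)
    (hφ0 : g.norm (differential φ x₀) ≠ 0) (hψ0 : g.norm (differential ψ x₀) ≠ 0)
    (hH : ∀ᶠ x in 𝓝 x₀, g.norm (differential φ x) ≠ 0 → g.norm (differential ψ x) ≠ 0 →
      g.meanCurvature dv p ψ x + b x (ψ x) (differential ψ x) ≤
        g.meanCurvature dv p φ x + b x (φ x) (differential φ x)) :
    ∀ᶠ y in 𝓝 (chart m x₀ x₀),
      (density dv x₀ y)⁻¹ * divergence (fun z => density dv x₀ z • fluxInChart g p ψ x₀ z) y +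
          lowerOrderInChart b x₀
            (y, (ψ ∘ (chart m x₀).symm) y, fderiv ℝ (ψ ∘ (chart m x₀).symm) y) ≤
        (density dv x₀ y)⁻¹ * divergence (fun z => density dv x₀ z • fluxInChart g p φ x₀ z) y +
          lowerOrderInChart b x₀
            (y, (φ ∘ (chart m x₀).symm) y, fderiv ℝ (φ ∘ (chart m x₀).symm) y) := by
  filter_upwards [eventually_mem_chart_target, eventually_nhds_iff_chart_symm.1 hφ,
    eventually_nhds_iff_chart_symm.1 hψ, eventually_norm_differential_ne_zero hφ hφ0,
    eventually_norm_differential_ne_zero hψ hψ0, eventually_nhds_iff_chart_symm.1 hH]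
    with y hy hφy hψy hφ0y hψ0y hHy
  have hHy := hHy hφ0y.1 hψ0y.1
  rwa [meanCurvature_eq g dv p hy hφy hφ0y.1, meanCurvature_eq g dv p hy hψy hψ0y.1,
    differential_eq_comp hy (hφy.mdifferentiableAt (by simp)),
    differential_eq_comp hy (hψy.mdifferentiableAt (by simp))] at hHy

theorem eventually_inner_raiseInChart_eq_zero_of_normal (hp : 0 ≤ p) {U : Set M}
    (hU : U ∈ 𝓝 x₀) (hφ : ∀ᶠ x in 𝓝 x₀, ContMDiffAt (𝓡 (m + 1)) 𝓘(ℝ, ℝ) ∞ φ x)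
    (hψ : ∀ᶠ x in 𝓝 x₀, ContMDiffAt (𝓡 (m + 1)) 𝓘(ℝ, ℝ) ∞ ψ x)
    (hφ0 : g.norm (differential φ x₀) ≠ 0) (hb : SmoothLowerOrderOn U b)
    (hH : ∀ᶠ x in 𝓝 x₀, g.norm (differential φ x) ≠ 0 → g.norm (differential ψ x) ≠ 0 →
      g.meanCurvature dv p ψ x + b x (ψ x) (differential ψ x) ≤
        g.meanCurvature dv p φ x + b x (φ x) (differential φ x))
    (hle : ∀ᶠ x in 𝓝 x₀, φ x ≤ ψ x) (hx₀ : ψ x₀ = φ x₀) :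
    ∀ᶠ x in 𝓝 (chart m x₀ x₀), (ψ ∘ (chart m x₀).symm) x = (φ ∘ (chart m x₀).symm) x → ∀ z,
      IsLocalMinOn (dist · z)
          {y | (ψ ∘ (chart m x₀).symm) y = (φ ∘ (chart m x₀).symm) y} x →
        ∀ η, 0 < p ∨ fderiv ℝ (φ ∘ (chart m x₀).symm) x (raiseInChart g x₀ x η) = 0 →
          inner ℝ (raiseInChart g x₀ x η) (z - x) = 0 := by
  have hφd := hφ.self_of_nhds.mdifferentiableAt (by simp)
  have hψ0 : g.norm (differential ψ x₀) ≠ 0 := by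
    rwa [differential_eq_of_le_of_eq hφd (hψ.self_of_nhds.mdifferentiableAt (by simp)) hle hx₀]
  have hy₀ := mem_extChartAt_target (I := 𝓡 (m + 1)) x₀
  exact eventually_inner_eq_zero_of_normal hp
    ((contDiffAt_raiseInChart g hy₀).of_le two_le_smooth)
    ((contDiffAt_density dv hy₀).of_le two_le_smooth) (density_ne_zero dv hy₀)
    (.of_forall (isNonnegForm_raiseInChart g x₀))
    ((eventually_contDiffAt_comp_chart_symm hφ).self_of_nhds.of_le two_le_smooth)
    ((eventually_contDiffAt_comp_chart_symm hψ).self_of_nhds.of_le two_le_smooth)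
    (by simp only [Function.comp_apply, extChartAt_to_inv, hx₀])
    (eventually_nhds_iff_chart_symm.1 hle)
    ((contDiffAt_lowerOrderInChart hb hU _ _).of_le (by simp))
    ((norm_differential_ne_zero_iff hφd).1 hφ0)
    (eventually_curvature_le_in_chart hφ hψ hφ0 hψ0 hH)

end ContactNormal

end Subriemannian

theorem theoremB_general {m : ℕ} {M : Type*} [TopologicalSpace M]
    [ChartedSpace (EuclideanSpace ℝ (Fin (m + 1))) M] [IsManifold (𝓡 (m + 1)) ∞ M]
    (g : CoMetric m M) (dv : VolumeForm m M)
    (U : Set M) (hU : IsOpen U) (p₀ : M) (hp₀ : p₀ ∈ U)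
    (φ ψ : M → ℝ)
    (hφ : ContMDiffOn (𝓡 (m + 1)) 𝓘(ℝ, ℝ) ∞ φ U)
    (hψ : ContMDiffOn (𝓡 (m + 1)) 𝓘(ℝ, ℝ) ∞ ψ U)
    (hφ₀ : g.norm (differential φ p₀) ≠ 0)
    (p : ℝ) (hp : 0 ≤ p)
    (b : Π x : M, ℝ → (TangentSpace (𝓡 (m + 1)) x →L[ℝ] ℝ) → ℝ)
    (hb : SmoothLowerOrderOn U b)
    (hH : ∀ x ∈ U, g.norm (differential φ x) ≠ 0 → g.norm (differential ψ x) ≠ 0 →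
      g.meanCurvature dv p ψ x + b x (ψ x) (differential ψ x) ≤
        g.meanCurvature dv p φ x + b x (φ x) (differential φ x))
    (hle : ∀ x ∈ U, φ x ≤ ψ x) (hφp : φ p₀ = 0) (hψp : ψ p₀ = 0) :
    (HasLieRankNear p₀ {x | φ x = 0}
        (fun x => g.horizontal x ⊓ LinearMap.ker (differential φ x).toLinearMap) m →
      ∀ᶠ x in 𝓝 p₀, φ x = 0 ↔ ψ x = 0) ∧
    (0 < p → HasLieRankNear p₀ Set.univ g.horizontal (m + 1) →
      ∀ᶠ x in 𝓝 p₀, ψ x = φ x) := by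
  have hU₀ : U ∈ 𝓝 p₀ := hU.mem_nhds hp₀
  have hφs : ∀ᶠ x in 𝓝 p₀, ContMDiffAt (𝓡 (m + 1)) 𝓘(ℝ, ℝ) ∞ φ x :=
    eventually_of_mem hU₀ fun x hx => hφ.contMDiffAt (hU.mem_nhds hx)
  have hψs : ∀ᶠ x in 𝓝 p₀, ContMDiffAt (𝓡 (m + 1)) 𝓘(ℝ, ℝ) ∞ ψ x :=
    eventually_of_mem hU₀ fun x hx => hψ.contMDiffAt (hU.mem_nhds hx)
  have hψc : ∀ᶠ x in 𝓝 p₀, ContinuousAt ψ x := hψs.mono fun _ hx => hx.continuousAt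
  have hle₀ : ∀ᶠ x in 𝓝 p₀, φ x ≤ ψ x := eventually_of_mem hU₀ hle
  have hψφ : ψ p₀ = φ p₀ := hψp.trans hφp.symm
  have hnormal := eventually_inner_raiseInChart_eq_zero_of_normal hp hU₀ hφs hψs hφ₀ hb
    (eventually_of_mem hU₀ hH) hle₀ hψφ
  refine ⟨fun hrank => ?_, fun hp' hrank => ?_⟩
  · have hsub : ∀ᶠ x in 𝓝 p₀, φ x = 0 → ψ x = 0 :=
      eventually_eq_zero_of_hasLieRankNear_levelSet hφs hφ₀ hψc hφp hψp hrank
        (hnormal.mono fun x hx h z hz η hη => hx h z hz η (.inr hη))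
    filter_upwards [hsub, eventually_eq_zero_imp_of_le hφs hψs hφ₀ hφp hψp hle₀ hsub]
      with x hφψ hψφ using ⟨hφψ, hψφ⟩
  · exact eventually_eq_of_hasLieRankNear (hφs.mono fun _ hx => hx.continuousAt) hψc hψφ hrank
      (hnormal.mono fun x hx h z hz η => hx h z hz η (.inl hp'))

theorem theoremB {m l : ℕ} (hm : 1 ≤ m) {M : Type*} [TopologicalSpace M] [T2Space M]
    [ChartedSpace (EuclideanSpace ℝ (Fin (m + 1))) M] [IsManifold (𝓡 (m + 1)) ∞ M]
    (g : CoMetric m M) (dv : VolumeForm m M)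
    (U : Set M) (hU : IsOpen U) (p₀ : M) (hp₀ : p₀ ∈ U)
    (hl : ∀ x ∈ U, Module.finrank ℝ (g.horizontal x) + l = m + 1)
    (φ ψ : M → ℝ)
    (hφ : ContMDiffOn (𝓡 (m + 1)) 𝓘(ℝ, ℝ) ∞ φ U)
    (hψ : ContMDiffOn (𝓡 (m + 1)) 𝓘(ℝ, ℝ) ∞ ψ U)
    (hφ₀ : g.norm (differential φ p₀) ≠ 0) (hψ₀ : g.norm (differential ψ p₀) ≠ 0)
    (p : ℝ) (hp : 0 ≤ p)
    (b : Π x : M, ℝ → (TangentSpace (𝓡 (m + 1)) x →L[ℝ] ℝ) → ℝ)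
    (hb : SmoothLowerOrderOn U b)
    (hbz : ∀ x ∈ U, ∀ (z : ℝ) (q : TangentSpace (𝓡 (m + 1)) x →L[ℝ] ℝ),
      deriv (fun t => b x t q) z ≤ 0)
    (hH : ∀ x ∈ U, g.norm (differential φ x) ≠ 0 → g.norm (differential ψ x) ≠ 0 →
      g.meanCurvature dv p ψ x + b x (ψ x) (differential ψ x) ≤
        g.meanCurvature dv p φ x + b x (φ x) (differential φ x))
    (hle : ∀ x ∈ U, φ x ≤ ψ x) (hφp : φ p₀ = 0) (hψp : ψ p₀ = 0) :
    (HasLieRankNear p₀ {x | φ x = 0}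
        (fun x => g.horizontal x ⊓ LinearMap.ker (differential φ x).toLinearMap) m →
      ∀ᶠ x in 𝓝 p₀, φ x = 0 ↔ ψ x = 0) ∧
    (0 < p → HasLieRankNear p₀ Set.univ g.horizontal (m + 1) →
      ∀ᶠ x in 𝓝 p₀, ψ x = φ x) :=
  theoremB_general g dv U hU p₀ hp₀ φ ψ hφ hψ hφ₀ p hp b hb hH hle hφp hψp
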